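/- **Theorem 3.2.** Let $p\ge 0$ be an integer and let $f$ be a function that is analytic on $H=\{z\in\mathbb C:\operatorname{Re}z>0\}$ and of exponential type there, i.e. $|f(z)|\le C(\operatorname{Re}z)\,e^{s|\operatorname{Im}z|}$ on $H$ for some $s\in\mathbb R$ and some locally bounded function $C$ on $(0,\infty)$. Suppose that 1. $f\in\mathcal T^{(p-1)}_{-2\pi,0;2\pi,0}$, that is, for every $t\in H$ both $\int_0^\infty |f(t+i\xi)|e^{-2\pi\xi}\,d\xi$ and $\int_{-\infty}^0 |f(t+i\xi)|e^{2\pi\xi}\,d\xi$ are finite, and both $$\int_0^\infty\Big|f(t+i\xi)-\sum_{j=0}^{p-1}\frac{f^{(j)}(t)}{j!}(i\xi)^j\Big|e^{-2\pi\xi}\,d\xi,\qquad \int_{-\infty}^0\Big|f(t+i\xi)-\sum_{j=0}^{p-1}\frac{f^{(j)}(t)}{j!}(i\xi)^j\Big|e^{2\pi\xi}\,d\xi$$ tend to $0$ as $\operatorname{Re}t\to\infty$, locally uniformly in $\operatorname{Im}t$; 2. $f^{(p)}(t+i\xi)\to 0$ as $t\to+\infty$ ($t$ real), locally uniformly in $\xi\in\mathbb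 R$. Then the Müller–Schleicher fractional sums of $f$ on $H$ exist, and for every $z$ with $\operatorname{Re}z>-1$ $$(\mathrm{MS})\text{-}\sum_{k=1}^{z}f(k)=\int_{\mathrm B}^{\mathrm B+z}f(k)\,dk:=F(\mathrm B+z)-F(\mathrm B),$$ where $F$ is any primitive of $f$ on $H$, and both $F(\mathrm B)$ and $F(\mathrm B+z)$ are defined. *Fractional sums.* The sums exist if there are polynomials $P_n$ ($n\in\mathbb N$) of uniformly bounded degree and a function $Q$ such that, for all $y$ with $y+1\in H$, $\lim_{n\to\infty}\big(\sum_{k=1}^n(f(k+y)-f(k))-P_n(y)\big)=-Q(y)$ and $Q(y+1)-Q(y)=f(y+1)$. One then puts $(\mathrm{MS})\text{-}\sum_{k=x}^{y}f(k)=Q(y)-Q(x-1)$ for $x,y+1\in H$; this does not depend on the choice of $P_n$ and $Q$. *Evaluation at the Bernoulli umbra.* Let $\mathcal B(w)=\frac{we^w}{e^w-1}$ on the strip $|\operatorname{Im}w|<2\pi$, with $\mathcal B(0)=1$. For $g$ analytic of exponential type on $\{\operatorname{Re}w\in I\}$, where $I$ is an open interval that meets $(0,1)$, put $$g(\mathrm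 B)=\frac1{\sqrt{2\pi}}\int_{-\infty}^{\infty}\widehat{\mathcal B}(\xi-it)\,g(t+i\xi)\,d\xi,\qquad \widehat{\mathcal B}(w)=\frac1{\sqrt{2\pi}}\int_{-\infty}^\infty\mathcal B(x)e^{-iwx}\,dx,$$ for any $t\in I\cap(0,1)$; this is defined when the integral converges absolutely for every such $t$, and its value does not depend on $t$. Here $(0,1)$ is the regular interval of the umbra $\mathrm B$: its end points are the infimum of the $s$ with $|\mathcal B(x-i\tau)|\le C(\tau)e^{sx}$ for all $x\ge0$, $|\tau|<2\pi$, and the supremum of the $s$ with the same bound for all $x\le0$, $|\tau|<2\pi$ ($C$ locally bounded). $F(\mathrm B)$ is the value for $g=F$, $I=(0,\infty)$, and $F(\mathrm B+z)$ is the value for $g(w)=F(w+z)$, $I=(-\operatorname{Re}z,\infty)$. -/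

import Mathlib

open Filter Topology MeasureTheory

noncomputable section

namespace Umbral

/-- A real function is locally bounded on a set of reals. -/
def LocallyBoundedOn (C : ℝ → ℝ) (J : Set ℝ) : Prop :=
  ∀ t ∈ J, ∃ M : ℝ, ∀ᶠ u in 𝓝[J] t, |C u| ≤ M

/-- The horizontal strip of all `x - i t` with `x` real and `t ∈ J`. -/
def hStrip (J : Set ℝ) : Set ℂ := {z | -z.im ∈ J}

/-- The vertical strip of all `z` with `Re z ∈ J`. -/
def vStrip (J : Set ℝ) : Set ℂ := {z | z.re ∈ J}

/-- Analytic functions of exponential type on a vertical strip `Re z ∈ J`: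
`|f z| ≤ C (Re z) * exp (s * |Im z|)` with `C` locally bounded. -/
def IsExpTypeV (J : Set ℝ) (f : ℂ → ℂ) : Prop :=
  DifferentiableOn ℂ f (vStrip J) ∧
    ∃ (s : ℝ) (C : ℝ → ℝ), LocallyBoundedOn C J ∧
      ∀ z ∈ vStrip J, ‖f z‖ ≤ C z.re * Real.exp (s * |z.im|)

/-! ### Umbrae -/

/-- The data of an umbra `(𝒜, Ω_{a,b})`: a generating function and the end points of the
dominating interval `(a, b)`. The conditions it has to satisfy are `Umbra.IsUmbra`. -/
structure Umbra where
  gen : ℂ → ℂ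
  lo : EReal
  hi : EReal

namespace Umbra

/-- The dominating interval `(a, b)`. -/
def dom (A : Umbra) : Set ℝ := {t | A.lo < (t : EReal) ∧ (t : EReal) < A.hi}

/-- The generating function is analytic of exponential type on `Ω_{a,b}`. -/
def IsUmbra (A : Umbra) : Prop :=
  A.lo < A.hi ∧ DifferentiableOn ℂ A.gen (hStrip A.dom) ∧
    ∃ (s : ℝ) (C : ℝ → ℝ), LocallyBoundedOn C A.dom ∧
      ∀ t ∈ A.dom, ∀ x : ℝ, ‖A.gen (x - t * Complex.I)‖ ≤ C t * Real.exp (s * |x|)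

/-- The positive index `α`. -/
def posIndex (A : Umbra) : EReal :=
  sInf (Real.toEReal '' {s : ℝ | ∃ C : ℝ → ℝ, LocallyBoundedOn C A.dom ∧
    ∀ t ∈ A.dom, ∀ x : ℝ, 0 ≤ x → ‖A.gen (x - t * Complex.I)‖ ≤ C t * Real.exp (s * x)})

/-- The negative index `β`. -/
def negIndex (A : Umbra) : EReal :=
  sSup (Real.toEReal '' {s : ℝ | ∃ C : ℝ → ℝ, LocallyBoundedOn C A.dom ∧
    ∀ t ∈ A.dom, ∀ x : ℝ, x ≤ 0 → ‖A.gen (x - t * Complex.I)‖ ≤ C t * Real.exp (s * x)})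

/-- A regular umbra: `α < β`. -/
def IsRegular (A : Umbra) : Prop := A.IsUmbra ∧ A.posIndex < A.negIndex

/-- The regular interval `(α, β)`. -/
def regInterval (A : Umbra) : Set ℝ :=
  {t | A.posIndex < (t : EReal) ∧ (t : EReal) < A.negIndex}

open Classical in
/-- The horizontal line `ℝ - i τ` in `Ω_{a,b}` on which the Fourier transform of the generating
function is computed: the real line if it lies in `Ω_{a,b}`, and some line in `Ω_{a,b}` otherwise.
By Cauchy's theorem the transform of a regular umbra does not depend on the line. -/
def baseLine (A : Umbra) : ℝ :=
  if (0 : ℝ) ∈ A.dom then 0 else Classical.epsilon fun t : ℝ => t ∈ A.dom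

/-- The Fourier transform
`(2π)^(-1/2) ∫_{ℝ - iτ} 𝒜(z) exp (-i w z) dz` of the generating function. -/
def fourier (A : Umbra) (w : ℂ) : ℂ :=
  (1 / (Real.sqrt (2 * Real.pi) : ℂ)) *
    ∫ x : ℝ, A.gen (x - A.baseLine * Complex.I) *
      Complex.exp (-Complex.I * w * (x - A.baseLine * Complex.I))

/-- The integrand `z ↦ 𝒜^(z) f(i z)` of the evaluation, on the line `z = x - i t`. -/
def evalIntegrand (A : Umbra) (f : ℂ → ℂ) (t x : ℝ) : ℂ :=
  A.fourier (x - t * Complex.I) * f (Complex.I * (x - t * Complex.I))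

/-- The class `𝒯_A(I)` of functions that can be evaluated at the regular umbra `A`. -/
def MemEval (A : Umbra) (I : Set ℝ) (f : ℂ → ℂ) : Prop :=
  A.IsRegular ∧ IsOpen I ∧ I.OrdConnected ∧ (I ∩ A.regInterval).Nonempty ∧
    IsExpTypeV I f ∧ ∀ t ∈ I ∩ A.regInterval, Integrable (A.evalIntegrand f t)

/-- `f ∈ 𝒯_A(I)` and `f(A) = v`, where
`f(A) = (2π)^(-1/2) ∫_{ℝ - it} 𝒜^(z) f(i z) dz` for any `t ∈ I ∩ (α, β)`. -/
def HasEval (A : Umbra) (I : Set ℝ) (f : ℂ → ℂ) (v : ℂ) : Prop :=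
  A.MemEval I f ∧ ∀ t ∈ I ∩ A.regInterval,
    (1 / (Real.sqrt (2 * Real.pi) : ℂ)) * ∫ x : ℝ, A.evalIntegrand f t x = v

end Umbra

open Classical in
/-- The Bernoulli umbra: `z e^z / (e^z - 1)` (with value `1` at the removable singularity `0`)
on the strip `|Im z| < 2π`. -/
def bernoulli : Umbra where
  gen z := if z = 0 then 1 else z * Complex.exp z / (Complex.exp z - 1)
  lo := ((-(2 * Real.pi) : ℝ) : EReal)
  hi := ((2 * Real.pi : ℝ) : EReal)

/-! ### The hierarchy -/

/-- The remainder `f(t + iξ) - ∑_{j < p} f^(j)(t) (iξ)^j / j!`. -/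
def taylorRem (p : ℕ) (f : ℂ → ℂ) (t : ℂ) (ξ : ℝ) : ℂ :=
  f (t + Complex.I * ξ) -
    ∑ j ∈ Finset.range p, iteratedDeriv j f t / (j.factorial : ℂ) * (Complex.I * ξ) ^ j

/-- One half of the hierarchy condition, on the half-line `S` with weight
`exp (-c ξ) (1 + |ξ|)^m`. The limit as `Re t → ∞` is locally uniform in `Im t`. -/
def HierarchyHalf (S : Set ℝ) (c m : ℝ) (p : ℕ) (f : ℂ → ℂ) : Prop :=
  (∀ t : ℂ, 0 < t.re →
    IntegrableOn
      (fun ξ : ℝ => ‖f (t + Complex.I * ξ)‖ * (Real.exp (-c * ξ) * (1 + |ξ|) ^ m)) S) ∧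
  ∀ R ε : ℝ, 0 < ε → ∀ᶠ x : ℝ in atTop, ∀ y : ℝ, |y| ≤ R →
    ∫⁻ ξ in S, ‖taylorRem p f (x + y * Complex.I) ξ‖ₑ *
      ENNReal.ofReal (Real.exp (-c * ξ) * (1 + |ξ|) ^ m) ≤ ENNReal.ofReal ε

/-- The class `𝒯^{(p-1)}_{a,k;b,l}`. -/
def MemHierarchy (a k b l : ℝ) (p : ℕ) (f : ℂ → ℂ) : Prop :=
  HierarchyHalf (Set.Ioi 0) b l p f ∧ HierarchyHalf (Set.Iio 0) a k p f ∧
    IsExpTypeV (Set.Ioi 0) f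

/-! ### Müller–Schleicher fractional sums -/

/-- `Q` is obtained from `f` and some sequence of polynomials of bounded degree as in the
definition of the Müller–Schleicher fractional sum, where `f` is a function on `U`, `1 ∈ U` and
`U + 1 ⊆ U`. -/
def IsMSAntidifference (U : Set ℂ) (f Q : ℂ → ℂ) : Prop :=
  ∃ P : ℕ → Polynomial ℂ, (∃ d : ℕ, ∀ n, (P n).natDegree ≤ d) ∧
    (∀ y : ℂ, y + 1 ∈ U →
      Tendsto (fun n : ℕ => ∑ k ∈ Finset.Icc 1 n, (f (k + y) - f k) - (P n).eval y)
        atTop (𝓝 (-Q y))) ∧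
    ∀ y : ℂ, y + 1 ∈ U → Q (y + 1) - Q y = f (y + 1)

/-- The Müller–Schleicher fractional sums of `f` exist. -/
def MSSummable (U : Set ℂ) (f : ℂ → ℂ) : Prop := ∃ Q, IsMSAntidifference U f Q

open Classical in
/-- The fractional sum `(MS)-∑_{k=x}^{y} f(k) = Q(y) - Q(x-1)`; it is `0` if there is no `Q`. -/
def msSum (U : Set ℂ) (f : ℂ → ℂ) (x y : ℂ) : ℂ :=
  if h : MSSummable U f then h.choose y - h.choose (x - 1) else 0

/-- The open right half-plane. -/
def rightHalfPlane : Set ℂ := {z | 0 < z.re}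

/-- `F` is a primitive of `f` on the open right half-plane. -/
def IsPrimitive (f F : ℂ → ℂ) : Prop := ∀ w ∈ rightHalfPlane, HasDerivAt F (f w) w

/-- `S = ∫_A^{A+z} f(k) dk`: the function `f` has primitives on the right half-plane and,
for each of them, `F(A)` and `F(A + z)` are defined and `F(A + z) - F(A) = S`. Here `F(A + z)`
is the value at `A` of `w ↦ F(w + z)`, which lives on the half-plane `Re w > - Re z`. -/
def HasUmbralIntegral (A : Umbra) (f : ℂ → ℂ) (z S : ℂ) : Prop :=
  (∃ F, IsPrimitive f F) ∧ ∀ F, IsPrimitive f F →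
    ∃ u v : ℂ, A.HasEval (Set.Ioi 0) F u ∧
      A.HasEval (Set.Ioi (-z.re)) (fun w => F (w + z)) v ∧ v - u = S

end Umbral

end

/-!
The Fourier transform of the Bernoulli umbra is explicit: integration over `ℝ + π i` and `ℝ - π i`
instead of `ℝ` reduces it to a beta integral, and with `K w = (π / sin (π w)) ^ 2`
(`bernoulliKernel`) the result is `F(B + z) = (2 π)⁻¹ ∫ K (t + i x) F (t + i x + z) dx`
(`bernoulli_fourier`). This kernel decays like `exp (-2 π |x|)`, which is the weight in the
hypothesis on `f`. By Tonelli's theorem, integration from `0` is bounded on `L¹(exp (-2 π |x|) dx)`,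
so the hypothesis passes from `f` to its primitives `F`, and the values `F(B + z)` exist.

They do not depend on `t`, by Cauchy's theorem. The integrand is only known to be integrable on each
vertical line and of some exponential type in between; this suffices because the factor
`exp (ε w ^ 2)` can be inserted and removed by dominated convergence (`integral_vertical_eq`).
When the line moves by one, it crosses the double pole of `K` at `1`, which yields the difference
equation `F(B + z + 1) - F(B + z) = f (z + 1)` (`bernoulliValue_add_one_sub`). Hence
`∑_{k=1}^n (f (k + y) - f k)` telescopes to `F(B + n + y) - F(B + n) - (F(B + y) - F(B))`.

It remains to approximate `F(B + n + y) - F(B + n)` by polynomials in `y` of bounded degree. The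
first hypothesis replaces `F` on the line of integration by its Taylor polynomial of degree `p`
(`tendsto_bernoulliValue_sub`), which leaves a combination of the values `F⁽ʲ⁾ (n + 1/2 + y)` with
`j ≤ p` whose coefficients are the moments of `K`. Since `F⁽ᵖ⁺¹⁾ = f⁽ᵖ⁾` tends to `0`, these values
are in turn approximated by Taylor polynomials in `y` (`tendsto_iteratedDeriv_sub_taylor`). So
`y ↦ F(B + y) - F(B)` is an antidifference in the sense of Müller and Schleicher. Any two of these
agree up to a constant, because a periodic limit of polynomials of bounded degree is constant
(`IsMSAntidifference.sub_eq_sub`); therefore the fractional sum is `F(B + z) - F(B)`.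
-/

noncomputable section

namespace Umbral

/-! ### Contour integrals over vertical lines -/

/-- Cauchy's theorem for the Gaussian regularization of `g` on a closed vertical strip: the factor
`exp (ε w ^ 2)` makes the integrals over the horizontal sides of long rectangles vanish. -/
lemma integral_vertical_gaussian_eq {g : ℂ → ℂ} {a b M s ε : ℝ} (hab : a ≤ b) (hε : 0 < ε)
    (hg : DifferentiableOn ℂ g {w | a ≤ w.re ∧ w.re ≤ b})
    (hbd : ∀ w : ℂ, a ≤ w.re → w.re ≤ b → 1 ≤ |w.im| → ‖g w‖ ≤ M * Real.exp (s * |w.im|))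
    (ha : Integrable fun y : ℝ => g (a + y * Complex.I) * Complex.exp (ε * (a + y * Complex.I) ^ 2))
    (hb : Integrable fun y : ℝ =>
      g (b + y * Complex.I) * Complex.exp (ε * (b + y * Complex.I) ^ 2)) :
    ∫ y : ℝ, g (a + y * Complex.I) * Complex.exp (ε * (a + y * Complex.I) ^ 2) =
      ∫ y : ℝ, g (b + y * Complex.I) * Complex.exp (ε * (b + y * Complex.I) ^ 2) := by
  set h : ℂ → ℂ := fun w => g w * Complex.exp (ε * w ^ 2) with hh
  have hd : DifferentiableOn ℂ h {w | a ≤ w.re ∧ w.re ≤ b} := by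
    apply hg.mul
    apply Differentiable.differentiableOn
    fun_prop
  have hrect : ∀ T : ℝ, (∫ x : ℝ in a..b, h (x + (-T : ℝ) * Complex.I)) -
      (∫ x : ℝ in a..b, h (x + T * Complex.I)) +
      Complex.I • (∫ y : ℝ in (-T)..T, h (b + y * Complex.I)) -
      Complex.I • (∫ y : ℝ in (-T)..T, h (a + y * Complex.I)) = 0 := by
    intro T
    have := Complex.integral_boundary_rect_eq_zero_of_differentiableOn h
      (a + (-T : ℝ) * Complex.I) (b + T * Complex.I) (hd.mono ?_)
    · simpa using this
    · intro w hw
      have := hw.1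
      simp [Set.uIcc_of_le hab] at this
      exact this
  have hM : 0 ≤ M := by
    have := (norm_nonneg _).trans (hbd (a + Complex.I) (by simp) (by simpa using hab) (by simp))
    exact nonneg_of_mul_nonneg_left this (Real.exp_pos _)
  set K : ℝ := max (a ^ 2) (b ^ 2) with hK
  have hnorm : ∀ T : ℝ, 1 ≤ |T| → ∀ x ∈ Set.Icc a b,
      ‖h (x + T * Complex.I)‖ ≤ M * Real.exp (ε * K) * Real.exp (s * |T| - ε * |T| ^ 2) := by
    intro T hT x hx
    have h1 := hbd (x + T * Complex.I) (by simpa using hx.1) (by simpa using hx.2)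
      (by simpa using hT)
    have h2 : ‖Complex.exp (ε * (x + T * Complex.I) ^ 2)‖ = Real.exp (ε * (x ^ 2 - T ^ 2)) := by
      rw [Complex.norm_exp]
      congr 1
      simp [pow_two]
    have hx2 : x ^ 2 ≤ K := by
      rcases le_total 0 x with h0 | h0
      · exact le_max_of_le_right (by nlinarith [hx.2])
      · exact le_max_of_le_left (by nlinarith [hx.1])
    simp only [hh, norm_mul, h2]
    simp only [Complex.add_im, Complex.ofReal_im, Complex.mul_im, Complex.ofReal_re, Complex.I_im,
      Complex.I_re, mul_one, mul_zero, add_zero, zero_add] at h1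
    calc _ ≤ (M * Real.exp (s * |T|)) * Real.exp (ε * K - ε * |T| ^ 2) := by
          gcongr
          rw [sq_abs]
          nlinarith
      _ = _ := by
          rw [mul_assoc, mul_assoc, ← Real.exp_add, ← Real.exp_add]
          ring_nf
  have hdecay : Tendsto (fun T : ℝ =>
      M * Real.exp (ε * K) * Real.exp (s * |T| - ε * |T| ^ 2) * |b - a|) atTop (𝓝 0) := by
    have h1 : Tendsto (fun T : ℝ => T * (s - ε * T)) atTop atBot := by
      apply tendsto_id.atTop_mul_atBot₀
      have h3 : Tendsto (fun T : ℝ => s + -(ε * T)) atTop atBot :=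
        tendsto_atBot_add_const_left _ s
          (tendsto_neg_atTop_atBot.comp (tendsto_id.const_mul_atTop hε))
      simpa only [sub_eq_add_neg] using h3
    have h2 : Tendsto (fun T : ℝ => Real.exp (s * |T| - ε * |T| ^ 2)) atTop (𝓝 0) := by
      apply (Real.tendsto_exp_atBot.comp h1).congr'
      filter_upwards [eventually_ge_atTop 0] with T hT
      simp only [Function.comp, abs_of_nonneg hT]
      ring_nf
    simpa using (h2.const_mul (M * Real.exp (ε * K))).mul_const |b - a|
  have hhor : ∀ σ : ℝ, |σ| = 1 →
      Tendsto (fun T : ℝ => ∫ x : ℝ in a..b, h (x + (σ * T : ℝ) * Complex.I)) atTop (𝓝 0) := by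
    intro σ hσ
    apply squeeze_zero_norm' _ hdecay
    filter_upwards [eventually_ge_atTop 1] with T hT
    have hT' : |σ * T| = |T| := by rw [abs_mul, hσ, one_mul]
    refine intervalIntegral.norm_integral_le_of_norm_le_const fun x hx => ?_
    rw [Set.uIoc_of_le hab] at hx
    have := hnorm (σ * T) (by rw [hT']; exact hT.trans (le_abs_self T)) x
      (Set.Ioc_subset_Icc_self hx)
    rwa [hT'] at this
  have hA := intervalIntegral_tendsto_integral ha tendsto_neg_atTop_atBot tendsto_id
  have hB := intervalIntegral_tendsto_integral hb tendsto_neg_atTop_atBot tendsto_id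
  have hlim := (((hhor (-1) (by simp)).sub (hhor 1 (by simp))).add (hB.const_smul Complex.I)).sub
    (hA.const_smul Complex.I)
  have h0 := tendsto_nhds_unique hlim (tendsto_const_nhds.congr fun T => by
    simpa using (hrect T).symm)
  have h1 : Complex.I • (∫ y : ℝ, h (b + y * Complex.I)) -
      Complex.I • (∫ y : ℝ, h (a + y * Complex.I)) = 0 := by simpa [hh] using h0
  rw [← smul_sub, smul_eq_zero] at h1
  exact (sub_eq_zero.1 (h1.resolve_left Complex.I_ne_zero)).symm

/-- The integral over a vertical line does not change when the line is moved across a strip on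
which the integrand is of exponential type. The integrand only has to be integrable on the two
lines; no decay in between is required. -/
theorem integral_vertical_eq {g : ℂ → ℂ} {a b M s : ℝ} (hab : a ≤ b)
    (hg : DifferentiableOn ℂ g {w | a ≤ w.re ∧ w.re ≤ b})
    (hbd : ∀ w : ℂ, a ≤ w.re → w.re ≤ b → 1 ≤ |w.im| → ‖g w‖ ≤ M * Real.exp (s * |w.im|))
    (ha : Integrable fun y : ℝ => g (a + y * Complex.I))
    (hb : Integrable fun y : ℝ => g (b + y * Complex.I)) :
    ∫ y : ℝ, g (a + y * Complex.I) = ∫ y : ℝ, g (b + y * Complex.I) := by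
  have hε : ∀ n : ℕ, (0 : ℝ) < 1 / (n + 1) := fun n => by positivity
  have hnorm : ∀ (c : ℝ) (n : ℕ) (y : ℝ),
      ‖Complex.exp ((1 / (n + 1) : ℝ) * (c + y * Complex.I) ^ 2)‖ ≤ Real.exp (c ^ 2) := by
    intro c n y
    rw [Complex.norm_exp, Real.exp_le_exp, Complex.re_ofReal_mul]
    have h1 : ((c + y * Complex.I : ℂ) ^ 2).re = c ^ 2 - y ^ 2 := by simp [pow_two]
    have h2 : (1 : ℝ) / (n + 1) ≤ 1 := by
      rw [div_le_one (by positivity)]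
      linarith [(Nat.cast_nonneg n : (0 : ℝ) ≤ n)]
    rw [h1]
    nlinarith [hε n, sq_nonneg c, sq_nonneg y, mul_nonneg (hε n).le (sq_nonneg y)]
  have hmeas : ∀ (c : ℝ) (n : ℕ), Continuous fun y : ℝ =>
      Complex.exp ((1 / (n + 1) : ℝ) * (c + y * Complex.I) ^ 2) := by
    intro c n
    fun_prop
  have hint : ∀ c : ℝ, Integrable (fun y : ℝ => g (c + y * Complex.I)) → ∀ n : ℕ,
      Integrable fun y : ℝ => g (c + y * Complex.I) *
        Complex.exp ((1 / (n + 1) : ℝ) * (c + y * Complex.I) ^ 2) := fun c hc n =>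
    hc.mul_bdd (c := Real.exp (c ^ 2)) (hmeas c n).aestronglyMeasurable
      (ae_of_all _ fun y => hnorm c n y)
  have hlim : ∀ c : ℝ, Integrable (fun y : ℝ => g (c + y * Complex.I)) →
      Tendsto (fun n : ℕ => ∫ y : ℝ, g (c + y * Complex.I) *
        Complex.exp ((1 / (n + 1) : ℝ) * (c + y * Complex.I) ^ 2)) atTop
        (𝓝 (∫ y : ℝ, g (c + y * Complex.I))) := by
    intro c hc
    apply tendsto_integral_of_dominated_convergence
      (fun y : ℝ => ‖g (c + y * Complex.I)‖ * Real.exp (c ^ 2))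
      (fun n => (hint c hc n).aestronglyMeasurable) (hc.norm.mul_const _)
    · intro n
      refine ae_of_all _ fun y => ?_
      rw [norm_mul]
      gcongr
      exact hnorm c n y
    · refine ae_of_all _ fun y => ?_
      have h1 : Tendsto (fun n : ℕ => (((1 / (n + 1) : ℝ)) : ℂ)) atTop (𝓝 ((0 : ℝ) : ℂ)) :=
        (Complex.continuous_ofReal.tendsto 0).comp tendsto_one_div_add_atTop_nhds_zero_nat
      have h2 := ((Complex.continuous_exp.tendsto _).comp
        (h1.mul_const ((c + y * Complex.I : ℂ) ^ 2))).const_mul (g (c + y * Complex.I))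
      simpa using h2
  refine tendsto_nhds_unique (hlim a ha) ((hlim b hb).congr fun n => ?_)
  exact (integral_vertical_gaussian_eq hab (hε n) hg hbd (hint a ha n) (hint b hb n)).symm

/-! ### Primitives on the right half-plane -/

lemma isOpen_vStrip {J : Set ℝ} (hJ : IsOpen J) : IsOpen (vStrip J) :=
  hJ.preimage Complex.continuous_re

lemma isOpen_rightHalfPlane : IsOpen rightHalfPlane := isOpen_vStrip isOpen_Ioi

/-- The half-plane is the increasing union of the disks about `n` of radius `n`; the primitives on
these disks that vanish at `1` are compatible. -/
theorem exists_isPrimitive {f : ℂ → ℂ} (hf : DifferentiableOn ℂ f rightHalfPlane) :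
    ∃ F, IsPrimitive f F := by
  set B : ℕ → Set ℂ := fun n => Metric.ball ((n + 1 : ℝ) : ℂ) (n + 1) with hB
  have hmem : ∀ n w, w ∈ B n ↔ w.re ^ 2 + w.im ^ 2 < 2 * (n + 1) * w.re := by
    intro n w
    have hn : (0 : ℝ) < n + 1 := by positivity
    rw [hB, Metric.mem_ball, Complex.dist_eq, ← sq_lt_sq₀ (norm_nonneg _) hn.le, Complex.sq_norm,
      Complex.normSq_apply]
    simp only [Complex.sub_re, Complex.sub_im, Complex.ofReal_re, Complex.ofReal_im, sub_zero]
    constructor <;> intro h <;> nlinarith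
  have hpos : ∀ n, ∀ w ∈ B n, 0 < w.re := by
    intro n w hw
    rw [hmem] at hw
    by_contra! h
    have : (0 : ℝ) < n + 1 := by positivity
    nlinarith [sq_nonneg w.re, sq_nonneg w.im]
  have hmono : ∀ m n, m ≤ n → B m ⊆ B n := by
    intro m n hmn w hw
    have h0 := hpos m w hw
    rw [hmem] at hw ⊢
    have : (m : ℝ) ≤ n := by exact_mod_cast hmn
    nlinarith
  have hone : ∀ n, (1 : ℂ) ∈ B n := by
    intro n
    rw [hmem]
    have : (0 : ℝ) ≤ n := by positivity
    simp
    linarith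
  have hex : ∀ n, ∃ G : ℂ → ℂ, G 1 = 0 ∧ ∀ w ∈ B n, HasDerivAt G (f w) w := by
    intro n
    obtain ⟨G, h1, h2⟩ := ((hf.mono (hpos n)).isExactOn_ball).with_val_at 1 0
    exact ⟨G, h1, h2⟩
  choose G hG1 hG using hex
  have hcompat : ∀ m n, m ≤ n → ∀ w ∈ B m, G n w = G m w := by
    intro m n hmn w hw
    refine Metric.isOpen_ball.eqOn_of_deriv_eq (convex_ball _ _).isPreconnected
      (f := G n) (g := G m) (s := B m) ?_ ?_ ?_ (hone m) ?_ hw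
    · exact fun z hz => (hG n z (hmono m n hmn hz)).differentiableAt.differentiableWithinAt
    · exact fun z hz => (hG m z hz).differentiableAt.differentiableWithinAt
    · intro z hz
      rw [(hG n z (hmono m n hmn hz)).deriv, (hG m z hz).deriv]
    · rw [hG1, hG1]
  have hcover : ∀ w ∈ rightHalfPlane, ∃ n, w ∈ B n := by
    intro w hw
    have hw' : 0 < w.re := hw
    obtain ⟨n, hn⟩ := exists_nat_gt ((w.re ^ 2 + w.im ^ 2) / (2 * w.re))
    refine ⟨n, (hmem n w).2 ?_⟩
    rw [div_lt_iff₀ (by positivity)] at hn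
    nlinarith
  classical
  choose! N hN using hcover
  refine ⟨fun w => G (N w) w, fun w hw => ?_⟩
  apply (hG (N w) w (hN w hw)).congr_of_eventuallyEq
  filter_upwards [Metric.isOpen_ball.mem_nhds (hN w hw)] with z hz
  have hz' : z ∈ B (N w) := hz
  rcases le_total (N w) (N z) with h | h
  · exact hcompat _ _ h z hz'
  · exact (hcompat _ _ h z (hN z (hpos _ z hz'))).symm

/-! ### The Bernoulli umbra is regular with regular interval `(0, 1)` -/

lemma locallyBoundedOn_of_continuousOn {C : ℝ → ℝ} {J : Set ℝ} (hC : ContinuousOn C J) :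
    LocallyBoundedOn C J := by
  intro t ht
  refine ⟨|C t| + 1, ?_⟩
  filter_upwards [(hC t ht).abs.eventually_lt_const (lt_add_one |C t|)] with u hu using hu.le

lemma mem_bernoulli_dom {t : ℝ} : t ∈ bernoulli.dom ↔ |t| < 2 * Real.pi := by
  simp only [Umbra.dom, bernoulli, Set.mem_ofPred_eq, EReal.coe_lt_coe_iff, abs_lt]

lemma bernoulli_baseLine : bernoulli.baseLine = 0 := by
  have : (0 : ℝ) ∈ bernoulli.dom := mem_bernoulli_dom.2 (by simpa using Real.pi_pos)
  rw [Umbra.baseLine, if_pos this]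

lemma exp_ne_one_of_abs_im_lt {z : ℂ} (hz : z ≠ 0) (him : |z.im| < 2 * Real.pi) :
    Complex.exp z ≠ 1 := by
  intro h
  obtain ⟨n, hn⟩ := Complex.exp_eq_one_iff.1 h
  have h1 : z.im = n * (2 * Real.pi) := by
    rw [hn]
    simp
  have h2 : n ≠ 0 := by
    rintro rfl
    exact hz (by simpa using hn)
  have h3 : (1 : ℝ) ≤ |(n : ℝ)| := by exact_mod_cast Int.one_le_abs h2
  rw [h1, abs_mul, abs_of_pos Real.two_pi_pos] at him
  nlinarith [Real.two_pi_pos]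

lemma dslope_exp_of_ne {z : ℂ} (hz : z ≠ 0) :
    dslope Complex.exp 0 z = (Complex.exp z - 1) / z := by
  rw [dslope_of_ne _ hz, slope_def_field]
  simp

lemma dslope_exp_zero : dslope Complex.exp 0 0 = 1 := by
  simp [dslope_same]

lemma dslope_exp_ne_zero {z : ℂ} (him : |z.im| < 2 * Real.pi) : dslope Complex.exp 0 z ≠ 0 := by
  rcases eq_or_ne z 0 with rfl | hz
  · simp
  · rw [dslope_exp_of_ne hz]
    exact div_ne_zero (sub_ne_zero.2 (exp_ne_one_of_abs_im_lt hz him)) hz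

lemma differentiable_dslope_exp : Differentiable ℂ (dslope Complex.exp 0) := by
  rw [← differentiableOn_univ, Complex.differentiableOn_dslope univ_mem]
  exact Complex.differentiable_exp.differentiableOn

lemma bernoulli_gen_of_ne {z : ℂ} (hz : z ≠ 0) :
    bernoulli.gen z = z * Complex.exp z / (Complex.exp z - 1) := by
  simp [bernoulli, hz]

lemma bernoulli_gen_zero : bernoulli.gen 0 = 1 := by simp [bernoulli]

lemma bernoulli_gen_eq_div (z : ℂ) :
    bernoulli.gen z = Complex.exp z / dslope Complex.exp 0 z := by
  rcases eq_or_ne z 0 with rfl | hz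
  · simp [bernoulli_gen_zero]
  · rw [bernoulli_gen_of_ne hz, dslope_exp_of_ne hz, div_div_eq_mul_div, mul_comm z]

lemma bernoulli_gen_eq_add {z : ℂ} (him : |z.im| < 2 * Real.pi) :
    bernoulli.gen z = z + 1 / dslope Complex.exp 0 z := by
  rcases eq_or_ne z 0 with rfl | hz
  · simp [bernoulli_gen_zero]
  · have := sub_ne_zero.2 (exp_ne_one_of_abs_im_lt hz him)
    rw [bernoulli_gen_of_ne hz, dslope_exp_of_ne hz]
    field_simp
    ring

/-- The reflection formula of the generating function. -/
lemma bernoulli_gen_reflect (z : ℂ) :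
    bernoulli.gen z = Complex.exp z * bernoulli.gen (-z) := by
  rcases eq_or_ne z 0 with rfl | hz
  · simp
  · rw [bernoulli_gen_of_ne hz, bernoulli_gen_of_ne (neg_ne_zero.2 hz), Complex.exp_neg]
    have h0 := Complex.exp_ne_zero z
    have h1 : (Complex.exp z)⁻¹ - 1 = -((Complex.exp z - 1) / Complex.exp z) := by
      field_simp
      ring
    rw [h1, neg_mul, neg_div_neg_eq, div_div_eq_mul_div, inv_mul_cancel_right₀ h0, mul_div_assoc',
      mul_comm z]

lemma differentiableOn_bernoulli_gen :
    DifferentiableOn ℂ bernoulli.gen {z | |z.im| < 2 * Real.pi} := by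
  have : bernoulli.gen = fun z => Complex.exp z / dslope Complex.exp 0 z :=
    funext bernoulli_gen_eq_div
  rw [this]
  exact Complex.differentiable_exp.differentiableOn.div differentiable_dslope_exp.differentiableOn
    fun z hz => dslope_exp_ne_zero hz

lemma sinc_half_ne_zero {t : ℝ} (ht : |t| < 2 * Real.pi) : Real.sinc (t / 2) ≠ 0 := by
  rcases eq_or_ne t 0 with rfl | h
  · simp
  · rw [Real.sinc_of_ne_zero (by simpa using h)]
    rw [abs_lt] at ht
    refine div_ne_zero ?_ (by simpa using h)
    rw [Ne, Real.sin_eq_zero_iff_of_lt_of_lt (by linarith) (by linarith)]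
    simpa using h

/-- The inequality `|e ^ z - 1| ≥ |z| |sinc (t / 2)|` for `z = x - i t`, `x ≥ 0`. -/
lemma abs_sinc_le_norm_dslope_exp {x : ℝ} (hx : 0 ≤ x) (t : ℝ) :
    |Real.sinc (t / 2)| ≤ ‖dslope Complex.exp 0 (x - t * Complex.I)‖ := by
  rcases eq_or_ne (x - t * Complex.I : ℂ) 0 with hz | hz
  · rw [hz, dslope_exp_zero, norm_one]
    exact Real.abs_sinc_le_one _
  rw [dslope_exp_of_ne hz, norm_div, le_div_iff₀ (norm_pos_iff.2 hz),
    ← sq_le_sq₀ (by positivity) (norm_nonneg _), mul_pow, sq_abs, Complex.sq_norm, Complex.sq_norm,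
    Complex.normSq_apply, Complex.normSq_apply]
  simp only [Complex.sub_re, Complex.sub_im, Complex.exp_re, Complex.exp_im, Complex.ofReal_re,
    Complex.ofReal_im, Complex.mul_re, Complex.mul_im, Complex.I_re, Complex.I_im, Complex.one_re,
    Complex.one_im, mul_zero, mul_one, zero_sub, sub_zero, add_zero, Real.cos_neg,
    Real.sin_neg]
  have h1 : t ^ 2 * Real.sinc (t / 2) ^ 2 = 4 * Real.sin (t / 2) ^ 2 := by
    rcases eq_or_ne t 0 with rfl | h
    · simp
    · rw [Real.sinc_of_ne_zero (by simpa using h)]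
      field_simp
      ring
  have h2 : Real.cos t = 1 - 2 * Real.sin (t / 2) ^ 2 := by
    have h3 := Real.cos_two_mul (t / 2)
    rw [Real.cos_sq', mul_div_cancel₀ t two_ne_zero] at h3
    linarith
  have h3 : Real.sinc (t / 2) ^ 2 ≤ 1 := by
    rw [sq_le_one_iff_abs_le_one]
    exact Real.abs_sinc_le_one _
  have h4 := Real.add_one_le_exp x
  have h5 : 1 ≤ Real.exp x := Real.one_le_exp hx
  have h6 : x ^ 2 ≤ (Real.exp x - 1) ^ 2 := by nlinarith
  have h7 : 4 * Real.sin (t / 2) ^ 2 ≤ 4 * Real.sin (t / 2) ^ 2 * Real.exp x :=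
    le_mul_of_one_le_right (by positivity) h5
  have h8 := Real.sin_sq_add_cos_sq t
  have h9 : (Real.exp x * Real.cos t - 1) * (Real.exp x * Real.cos t - 1) +
      Real.exp x * -Real.sin t * (Real.exp x * -Real.sin t) =
      (Real.exp x - 1) ^ 2 + 4 * Real.sin (t / 2) ^ 2 * Real.exp x := by
    calc _ = Real.exp x ^ 2 * (Real.sin t ^ 2 + Real.cos t ^ 2) -
          2 * Real.exp x * Real.cos t + 1 := by
          ring
      _ = _ := by
          rw [h8, h2]
          ring
  have h10 : Real.sinc (t / 2) ^ 2 * x ^ 2 ≤ x ^ 2 := mul_le_of_le_one_left (sq_nonneg x) h3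
  rw [show Real.sinc (t / 2) ^ 2 * (x * x + -t * -t) =
    Real.sinc (t / 2) ^ 2 * x ^ 2 + t ^ 2 * Real.sinc (t / 2) ^ 2 by ring, h1, h9]
  linarith

/-- The locally bounded coefficient in the growth estimates of the generating function. -/
def bernoulliCoeff (t : ℝ) : ℝ := |t| + 1 / |Real.sinc (t / 2)|

lemma bernoulliCoeff_nonneg (t : ℝ) : 0 ≤ bernoulliCoeff t := by
  unfold bernoulliCoeff
  positivity

lemma bernoulliCoeff_neg (t : ℝ) : bernoulliCoeff (-t) = bernoulliCoeff t := by
  rw [bernoulliCoeff, bernoulliCoeff, neg_div, Real.sinc_neg, abs_neg]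

lemma continuousOn_bernoulliCoeff : ContinuousOn bernoulliCoeff bernoulli.dom := by
  refine continuous_abs.continuousOn.add (continuousOn_const.div ?_ fun t ht =>
    abs_ne_zero.2 (sinc_half_ne_zero (mem_bernoulli_dom.1 ht)))
  exact (Real.continuous_sinc.comp (continuous_id.div_const 2)).abs.continuousOn

lemma norm_bernoulli_gen_le_of_nonneg {x t : ℝ} (hx : 0 ≤ x) (ht : |t| < 2 * Real.pi) :
    ‖bernoulli.gen (x - t * Complex.I)‖ ≤ x + bernoulliCoeff t := by
  rw [bernoulli_gen_eq_add (by simpa using ht)]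
  refine (norm_add_le _ _).trans ?_
  rw [norm_div, norm_one, bernoulliCoeff, ← add_assoc]
  refine add_le_add ((norm_sub_le _ _).trans ?_) ?_
  · simp [abs_of_nonneg hx]
  · exact one_div_le_one_div_of_le (abs_pos.2 (sinc_half_ne_zero ht))
      (abs_sinc_le_norm_dslope_exp hx t)

lemma norm_bernoulli_gen_le_of_nonpos {x t : ℝ} (hx : x ≤ 0) (ht : |t| < 2 * Real.pi) :
    ‖bernoulli.gen (x - t * Complex.I)‖ ≤ (-x + bernoulliCoeff t) * Real.exp x := by
  have h := norm_bernoulli_gen_le_of_nonneg (neg_nonneg.2 hx) (t := -t) (by simpa using ht)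
  rw [bernoulli_gen_reflect, norm_mul, Complex.norm_exp, mul_comm]
  rw [bernoulliCoeff_neg] at h
  have h1 : (-(x - t * Complex.I) : ℂ) = ((-x : ℝ) : ℂ) - ((-t : ℝ) : ℂ) * Complex.I := by
    push_cast
    ring
  rw [h1]
  simpa using mul_le_mul_of_nonneg_right h (Real.exp_pos x).le

lemma add_le_mul_exp {x A ε : ℝ} (hx : 0 ≤ x) (hA : 0 ≤ A) (hε : 0 < ε) :
    x + A ≤ (1 / ε + A) * Real.exp (ε * x) := by
  have h1 := Real.add_one_le_exp (ε * x)
  have h2 : 1 ≤ Real.exp (ε * x) := Real.one_le_exp (by positivity)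
  have h3 : x ≤ 1 / ε * Real.exp (ε * x) := by
    rw [one_div, inv_mul_eq_div, le_div_iff₀ hε]
    linarith
  nlinarith

lemma norm_bernoulli_gen_ofReal_ge {x : ℝ} (hx : 0 < x) : x ≤ ‖bernoulli.gen x‖ := by
  have h : bernoulli.gen x = ((x * Real.exp x / (Real.exp x - 1) : ℝ) : ℂ) := by
    rw [bernoulli_gen_of_ne (by exact_mod_cast hx.ne')]
    push_cast
    rfl
  have h1 : 0 < Real.exp x - 1 := by linarith [Real.add_one_le_exp x]
  rw [h, Complex.norm_real]
  refine le_trans ?_ (le_abs_self _)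
  rw [le_div_iff₀ h1]
  nlinarith

lemma bernoulli_isUmbra : bernoulli.IsUmbra := by
  refine ⟨?_, ?_, 1, fun t => 1 + bernoulliCoeff t, ?_, ?_⟩
  · simp only [bernoulli, EReal.coe_lt_coe_iff]
    linarith [Real.pi_pos]
  · refine differentiableOn_bernoulli_gen.mono fun z hz => ?_
    have := mem_bernoulli_dom.1 hz
    rwa [abs_neg] at this
  · exact locallyBoundedOn_of_continuousOn (continuousOn_const.add continuousOn_bernoulliCoeff)
  · intro t ht x
    have ht' := mem_bernoulli_dom.1 ht
    have h := add_le_mul_exp (abs_nonneg x) (bernoulliCoeff_nonneg t) one_pos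
    rw [one_div_one] at h
    refine le_trans ?_ h
    rcases le_total 0 x with hx | hx
    · rw [abs_of_nonneg hx]
      exact norm_bernoulli_gen_le_of_nonneg hx ht'
    · rw [abs_of_nonpos hx]
      refine (norm_bernoulli_gen_le_of_nonpos hx ht').trans (mul_le_of_le_one_right ?_ ?_)
      · linarith [bernoulliCoeff_nonneg t]
      · exact Real.exp_le_one_iff.2 hx

lemma zero_mem_bernoulli_dom : (0 : ℝ) ∈ bernoulli.dom :=
  mem_bernoulli_dom.2 (by simpa using Real.pi_pos)

lemma bernoulli_posIndex : bernoulli.posIndex = 0 := by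
  apply le_antisymm
  · refine EReal.le_of_forall_lt_iff_le.1 fun ε hε => ?_
    have hε' : 0 < ε := by exact_mod_cast hε
    refine sInf_le ⟨ε, ⟨fun t => 1 / ε + bernoulliCoeff t, ?_, ?_⟩, rfl⟩
    · exact locallyBoundedOn_of_continuousOn (continuousOn_const.add continuousOn_bernoulliCoeff)
    · intro t ht x hx
      exact (norm_bernoulli_gen_le_of_nonneg hx (mem_bernoulli_dom.1 ht)).trans
        (add_le_mul_exp hx (bernoulliCoeff_nonneg t) hε')
  · refine le_sInf ?_
    rintro _ ⟨s, ⟨C, -, hC⟩, rfl⟩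
    norm_cast
    by_contra! hs
    have hx : 0 < |C 0| + 1 := by positivity
    have h1 := hC 0 zero_mem_bernoulli_dom (|C 0| + 1) hx.le
    have h2 := norm_bernoulli_gen_ofReal_ge hx
    have h3 : C 0 * Real.exp (s * (|C 0| + 1)) ≤ |C 0| := by
      refine (mul_le_mul_of_nonneg_right (le_abs_self _) (Real.exp_pos _).le).trans
        (mul_le_of_le_one_right (abs_nonneg _) ?_)
      rw [Real.exp_le_one_iff]
      nlinarith
    rw [Complex.ofReal_zero, zero_mul, sub_zero] at h1
    linarith

lemma bernoulli_negIndex : bernoulli.negIndex = 1 := by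
  apply le_antisymm
  · refine sSup_le ?_
    rintro _ ⟨s, ⟨C, -, hC⟩, rfl⟩
    norm_cast
    by_contra! hs
    have hx : 0 < |C 0| + 1 := by positivity
    have h1 := hC 0 zero_mem_bernoulli_dom (-(|C 0| + 1)) (by linarith)
    have h2 := norm_bernoulli_gen_ofReal_ge hx
    rw [Complex.ofReal_zero, zero_mul, sub_zero, bernoulli_gen_reflect, norm_mul, Complex.norm_exp,
      Complex.ofReal_re, Complex.ofReal_neg, neg_neg] at h1
    set u := |C 0| + 1 with hu
    have h3 : C 0 * Real.exp (s * -u) ≤ |C 0| * Real.exp (-u) := by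
      refine mul_le_mul (le_abs_self _) ?_ (Real.exp_pos _).le (abs_nonneg _)
      rw [Real.exp_le_exp]
      nlinarith
    have h4 : Real.exp (-u) * u ≤ Real.exp (-u) * |C 0| := by
      rw [mul_comm _ |C 0|]
      exact (mul_le_mul_of_nonneg_left h2 (Real.exp_pos _).le).trans (h1.trans h3)
    have h5 := le_of_mul_le_mul_left h4 (Real.exp_pos _)
    linarith
  · refine EReal.ge_of_forall_gt_iff_ge.1 fun r hr => ?_
    have hr' : r < 1 := by exact_mod_cast hr
    refine le_sSup ⟨r, ⟨fun t => 1 / (1 - r) + bernoulliCoeff t, ?_, ?_⟩, rfl⟩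
    · exact locallyBoundedOn_of_continuousOn (continuousOn_const.add continuousOn_bernoulliCoeff)
    · intro t ht x hx
      refine (norm_bernoulli_gen_le_of_nonpos hx (mem_bernoulli_dom.1 ht)).trans ?_
      have h := add_le_mul_exp (neg_nonneg.2 hx) (bernoulliCoeff_nonneg t) (sub_pos.2 hr')
      calc _ ≤ (1 / (1 - r) + bernoulliCoeff t) * Real.exp ((1 - r) * -x) * Real.exp x :=
            mul_le_mul_of_nonneg_right h (Real.exp_pos x).le
        _ = _ := by
            rw [mul_assoc, ← Real.exp_add]
            ring_nf

lemma bernoulli_isRegular : bernoulli.IsRegular :=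
  ⟨bernoulli_isUmbra, by rw [bernoulli_posIndex, bernoulli_negIndex]; exact zero_lt_one⟩

lemma bernoulli_regInterval : bernoulli.regInterval = Set.Ioo 0 1 := by
  ext t
  rw [Umbra.regInterval, bernoulli_posIndex, bernoulli_negIndex]
  simp only [Set.mem_ofPred_eq, Set.mem_Ioo]
  norm_cast

/-! ### The Fourier transform of the Bernoulli umbra -/

lemma integrable_exp_neg_mul_abs {c : ℝ} (hc : 0 < c) :
    Integrable fun x : ℝ => Real.exp (-c * |x|) := by
  rw [← integrableOn_univ, ← Set.Iic_union_Ioi (a := (0 : ℝ)), integrableOn_union]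
  constructor
  · refine (integrableOn_exp_mul_Iic hc 0).congr_fun (fun x hx => ?_) measurableSet_Iic
    simp only [Set.mem_Iic] at hx
    simp only [abs_of_nonpos hx, neg_mul_neg]
  · refine (integrableOn_exp_mul_Ioi (neg_neg_of_pos hc) 0).congr_fun (fun x hx => ?_)
      measurableSet_Ioi
    simp only [Set.mem_Ioi] at hx
    simp only [abs_of_pos hx]

/-- The substitution `u = sigmoid x` turns the integral into the beta integral at `(1 - σ, σ)`,
which Euler's reflection formula evaluates. -/
lemma integral_sigmoid_mul_exp {σ : ℂ} (h0 : 0 < σ.re) (h1 : σ.re < 1) :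
    ∫ x : ℝ, (Real.sigmoid x : ℂ) * Complex.exp (-σ * x) =
      Real.pi / Complex.sin (Real.pi * σ) := by
  have hbeta : Complex.betaIntegral (1 - σ) σ = Real.pi / Complex.sin (Real.pi * σ) := by
    have h := Complex.Gamma_mul_Gamma_eq_betaIntegral (s := 1 - σ) (t := σ) (by simpa using h1) h0
    rw [sub_add_cancel, Complex.Gamma_one, one_mul, mul_comm,
      Complex.Gamma_mul_Gamma_one_sub] at h
    exact h.symm
  rw [← hbeta, Complex.betaIntegral, intervalIntegral.integral_of_le zero_le_one,
    integral_Ioc_eq_integral_Ioo, ← Real.range_sigmoid, ← Set.image_univ,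
    integral_image_eq_integral_abs_deriv_smul MeasurableSet.univ
      (fun x _ => (Real.hasDerivAt_sigmoid x).hasDerivWithinAt)
      (Real.sigmoid_injective.injOn), setIntegral_univ]
  refine integral_congr_ae (ae_of_all _ fun x => ?_)
  have hp := Real.sigmoid_pos x
  have hq : 0 < 1 - Real.sigmoid x := sub_pos.2 (Real.sigmoid_lt_one x)
  have hrel : Real.sigmoid x = Real.exp x * (1 - Real.sigmoid x) := by
    rw [← Real.sigmoid_neg, ← Real.sigmoid_mul_rexp_neg, mul_left_comm, ← Real.exp_add]
    simp
  have hpow : (Real.sigmoid x : ℂ) ^ (-σ) =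
      Complex.exp (-σ * x) * ((1 - Real.sigmoid x : ℝ) : ℂ) ^ (-σ) := by
    conv_lhs => rw [hrel]
    rw [Complex.ofReal_mul, Complex.mul_cpow_ofReal_nonneg (Real.exp_pos x).le hq.le]
    congr 1
    rw [Complex.cpow_def_of_ne_zero (by exact_mod_cast (Real.exp_pos x).ne'), ← Complex.ofReal_log
      (Real.exp_pos x).le, Real.log_exp, mul_comm]
  have hq' : ((1 - Real.sigmoid x : ℝ) : ℂ) ≠ 0 := by exact_mod_cast hq.ne'
  have hcast : (1 - (Real.sigmoid x : ℂ)) = ((1 - Real.sigmoid x : ℝ) : ℂ) := by push_cast; rfl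
  simp only [abs_of_pos (mul_pos hp hq), Complex.real_smul]
  rw [show 1 - σ - 1 = -σ by ring, hpow, hcast, Complex.cpow_sub _ _ hq', Complex.cpow_neg,
    Complex.cpow_one, Complex.ofReal_mul]
  have hne : ((1 - Real.sigmoid x : ℝ) : ℂ) ^ σ ≠ 0 := by
    rw [Complex.cpow_def_of_ne_zero hq']
    exact Complex.exp_ne_zero _
  generalize ((1 - Real.sigmoid x : ℝ) : ℂ) = q at *
  field_simp

lemma norm_exp_neg_mul (σ : ℂ) (x t : ℝ) :
    ‖Complex.exp (-σ * (x - t * Complex.I))‖ = Real.exp (-(σ.re * x) - σ.im * t) := by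
  rw [Complex.norm_exp]
  congr 1
  simp
  ring

lemma integrable_bernoulli_gen_mul_exp {σ : ℂ} (h0 : 0 < σ.re) (h1 : σ.re < 1) {t : ℝ}
    (ht : |t| < 2 * Real.pi) :
    Integrable fun x : ℝ =>
      bernoulli.gen (x - t * Complex.I) * Complex.exp (-σ * (x - t * Complex.I)) := by
  set r := σ.re with hr
  set ε := min r (1 - r) / 2 with hε
  have hε0 : 0 < ε := half_pos (lt_min h0 (sub_pos.2 h1))
  have hε1 : 2 * ε ≤ r := by
    rw [hε, mul_div_cancel₀ _ two_ne_zero]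
    exact min_le_left _ _
  have hε2 : 2 * ε ≤ 1 - r := by
    rw [hε, mul_div_cancel₀ _ two_ne_zero]
    exact min_le_right _ _
  have hcont : Continuous fun x : ℝ =>
      bernoulli.gen (x - t * Complex.I) * Complex.exp (-σ * (x - t * Complex.I)) := by
    refine Continuous.mul ?_ (by fun_prop)
    refine differentiableOn_bernoulli_gen.continuousOn.comp_continuous (by fun_prop) fun x => ?_
    simpa using ht
  refine ((integrable_exp_neg_mul_abs hε0).const_mul
    ((1 / ε + bernoulliCoeff t) * Real.exp (-(σ.im * t)))).mono' hcont.aestronglyMeasurable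
    (ae_of_all _ fun x => ?_)
  rw [norm_mul, norm_exp_neg_mul]
  have hA := add_le_mul_exp (abs_nonneg x) (bernoulliCoeff_nonneg t) hε0
  have hB : 0 ≤ 1 / ε + bernoulliCoeff t := add_nonneg (by positivity) (bernoulliCoeff_nonneg t)
  rcases le_total 0 x with hx | hx
  · rw [abs_of_nonneg hx] at hA ⊢
    calc _ ≤ (1 / ε + bernoulliCoeff t) * Real.exp (ε * x) * Real.exp (-(r * x) - σ.im * t) :=
          mul_le_mul_of_nonneg_right ((norm_bernoulli_gen_le_of_nonneg hx ht).trans hA)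
            (Real.exp_pos _).le
      _ ≤ _ := by
          rw [mul_assoc, mul_assoc, ← Real.exp_add, ← Real.exp_add]
          refine mul_le_mul_of_nonneg_left (Real.exp_le_exp.2 ?_) hB
          nlinarith
  · rw [abs_of_nonpos hx] at hA ⊢
    calc _ ≤ (1 / ε + bernoulliCoeff t) * Real.exp (ε * -x) * Real.exp x *
            Real.exp (-(r * x) - σ.im * t) :=
          mul_le_mul_of_nonneg_right ((norm_bernoulli_gen_le_of_nonpos hx ht).trans
            (mul_le_mul_of_nonneg_right hA (Real.exp_pos x).le)) (Real.exp_pos _).le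
      _ ≤ _ := by
          rw [mul_assoc, mul_assoc, mul_assoc, ← Real.exp_add, ← Real.exp_add, ← Real.exp_add]
          refine mul_le_mul_of_nonneg_left (Real.exp_le_exp.2 ?_) hB
          nlinarith

/-- Cauchy's theorem for the Fourier integral of the Bernoulli umbra. -/
lemma integral_bernoulli_gen_line_eq {σ : ℂ} (h0 : 0 < σ.re) (h1 : σ.re < 1) {t u : ℝ}
    (htu : t ≤ u) (ht : -Real.pi ≤ t) (hu : u ≤ Real.pi) :
    ∫ x : ℝ, bernoulli.gen (x - t * Complex.I) * Complex.exp (-σ * (x - t * Complex.I)) =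
      ∫ x : ℝ, bernoulli.gen (x - u * Complex.I) * Complex.exp (-σ * (x - u * Complex.I)) := by
  have hpi := Real.pi_pos
  -- The strip is turned by a right angle, so that the lines become vertical.
  have hrot : ∀ c x : ℝ, -Complex.I * (c + x * Complex.I) = x - c * Complex.I := by
    intro c x
    linear_combination (-(x : ℂ)) * Complex.I_mul_I
  have hIcc : Set.Icc (-Real.pi) Real.pi ⊆ bernoulli.dom := fun c hc =>
    mem_bernoulli_dom.2 ((abs_le.2 hc).trans_lt (by linarith))
  obtain ⟨K, hK⟩ := isCompact_Icc.exists_bound_of_continuousOn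
    (continuousOn_bernoulliCoeff.mono hIcc)
  have h := integral_vertical_eq (a := t) (b := u) (M := (1 + K) * Real.exp (|σ.im| * Real.pi))
    (s := 1 + |σ.re|)
    (g := fun w => bernoulli.gen (-Complex.I * w) * Complex.exp (-σ * (-Complex.I * w))) htu
    ?_ ?_ ?_ ?_
  · simpa only [hrot] using h
  · refine DifferentiableOn.mul ?_ (Differentiable.differentiableOn (by fun_prop))
    refine differentiableOn_bernoulli_gen.comp (by fun_prop) fun w hw => ?_
    have hw' : t ≤ w.re ∧ w.re ≤ u := hw
    simp only [Set.mem_ofPred_eq, Complex.mul_im, Complex.neg_im, Complex.I_re,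
      Complex.I_im, zero_mul, zero_add, neg_mul, one_mul, abs_neg]
    exact (abs_le.2 ⟨by linarith, by linarith⟩ : |w.re| ≤ Real.pi).trans_lt (by linarith)
  · intro w hw1 hw2 _
    have hc : w.re ∈ Set.Icc (-Real.pi) Real.pi := ⟨by linarith, by linarith⟩
    have hc' : |w.re| < 2 * Real.pi := mem_bernoulli_dom.1 (hIcc hc)
    have hw : -Complex.I * w = w.im - w.re * Complex.I := by
      conv_lhs => rw [← Complex.re_add_im w]
      exact hrot _ _
    rw [hw, norm_mul, norm_exp_neg_mul]
    have hA := add_le_mul_exp (abs_nonneg w.im) (bernoulliCoeff_nonneg w.re) one_pos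
    have hK' := (le_abs_self _).trans (hK _ hc)
    have hgen : ‖bernoulli.gen (w.im - w.re * Complex.I)‖ ≤ |w.im| + bernoulliCoeff w.re := by
      rcases le_total 0 w.im with hx | hx
      · rw [abs_of_nonneg hx]
        exact norm_bernoulli_gen_le_of_nonneg hx hc'
      · rw [abs_of_nonpos hx]
        refine (norm_bernoulli_gen_le_of_nonpos hx hc').trans (mul_le_of_le_one_right ?_ ?_)
        · linarith [bernoulliCoeff_nonneg w.re]
        · exact Real.exp_le_one_iff.2 hx
    have hgen2 : ‖bernoulli.gen (w.im - w.re * Complex.I)‖ ≤ (1 + K) * Real.exp |w.im| := by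
      refine (hgen.trans hA).trans ?_
      rw [one_div_one, one_mul]
      exact mul_le_mul_of_nonneg_right (by linarith) (Real.exp_pos _).le
    have hK0 : 0 ≤ 1 + K := by linarith [bernoulliCoeff_nonneg w.re]
    have hexp : -(σ.re * w.im) - σ.im * w.re ≤ |σ.re| * |w.im| + |σ.im| * Real.pi := by
      have e1 : -(σ.re * w.im) ≤ |σ.re| * |w.im| := by
        rw [← abs_mul]
        exact neg_le_abs _
      have e2 : -(σ.im * w.re) ≤ |σ.im| * Real.pi := by
        refine (neg_le_abs _).trans ?_
        rw [abs_mul]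
        exact mul_le_mul_of_nonneg_left (abs_le.2 hc) (abs_nonneg _)
      linarith
    calc _ ≤ (1 + K) * Real.exp |w.im| * Real.exp (|σ.re| * |w.im| + |σ.im| * Real.pi) :=
          mul_le_mul hgen2 (Real.exp_le_exp.2 hexp) (Real.exp_pos _).le (by positivity)
      _ = _ := by
          rw [mul_assoc, mul_assoc, ← Real.exp_add, ← Real.exp_add]
          ring_nf
  · simpa only [hrot] using integrable_bernoulli_gen_mul_exp h0 h1
      (abs_lt.2 ⟨by linarith, by linarith⟩)
  · simpa only [hrot] using integrable_bernoulli_gen_mul_exp h0 h1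
      (abs_lt.2 ⟨by linarith, by linarith⟩)

lemma sin_pi_mul_ne_zero {w : ℂ} (h0 : 0 < w.re) (h1 : w.re < 1) :
    Complex.sin (Real.pi * w) ≠ 0 := by
  rw [Ne, Complex.sin_eq_zero_iff]
  rintro ⟨k, hk⟩
  rw [mul_comm, mul_left_inj' (by exact_mod_cast Real.pi_ne_zero)] at hk
  rw [hk, Complex.intCast_re] at h0 h1
  have h2 : 0 < k := by exact_mod_cast h0
  have h3 : k < 1 := by exact_mod_cast h1
  omega

lemma bernoulli_gen_of_exp_eq_neg (x : ℝ) {z : ℂ} (hz : z ≠ 0)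
    (h : Complex.exp z = -(Real.exp x : ℂ)) : bernoulli.gen z = z * Real.sigmoid x := by
  have h1 : (1 + Complex.exp (-x : ℂ)) ≠ 0 := by
    have : (0 : ℝ) < 1 + Real.exp (-x) := by positivity
    exact_mod_cast this.ne'
  have h2 : (Complex.exp x + 1) ≠ 0 := by
    have : (0 : ℝ) < Real.exp x + 1 := by positivity
    exact_mod_cast this.ne'
  rw [bernoulli_gen_of_ne hz, h, Real.sigmoid_def, mul_div_assoc]
  push_cast
  congr 1
  rw [show -Complex.exp x - 1 = -(Complex.exp x + 1) by ring, neg_div_neg_eq, div_eq_iff h2,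
    inv_mul_eq_div, eq_div_iff h1, mul_add, ← Complex.exp_add]
  simp

/-- Shifting the line of integration by `± π i` gives two expressions for the integral. Their
difference, after the exponential factors are removed, is the integral of the logistic function. -/
theorem integral_bernoulli_gen_mul_exp {σ : ℂ} (h0 : 0 < σ.re) (h1 : σ.re < 1) :
    ∫ x : ℝ, bernoulli.gen x * Complex.exp (-σ * x) =
      (Real.pi / Complex.sin (Real.pi * σ)) ^ 2 := by
  have hpi := Real.pi_pos
  set J := ∫ x : ℝ, bernoulli.gen x * Complex.exp (-σ * x) with hJ
  have hJ0 : J = ∫ x : ℝ, bernoulli.gen (x - (0 : ℝ) * Complex.I) *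
      Complex.exp (-σ * (x - (0 : ℝ) * Complex.I)) := by simp [hJ]
  have hup := integral_bernoulli_gen_line_eq h0 h1 (t := 0) (u := Real.pi) hpi.le
    (by linarith) le_rfl
  have hdn := integral_bernoulli_gen_line_eq h0 h1 (t := -Real.pi) (u := 0) (by linarith)
    le_rfl hpi.le
  rw [← hJ0] at hup hdn
  have hint1 := integrable_bernoulli_gen_mul_exp h0 h1 (t := Real.pi)
    (by rw [abs_of_pos hpi]; linarith)
  have hint2 := integrable_bernoulli_gen_mul_exp h0 h1 (t := -Real.pi)
    (by rw [abs_neg, abs_of_pos hpi]; linarith)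
  set c := Complex.exp (Real.pi * σ * Complex.I) with hc
  set d := Complex.exp (-(Real.pi * σ) * Complex.I) with hd
  have hcd : c * d = 1 := by
    rw [hc, hd, ← Complex.exp_add]
    simp
  have hne : ∀ (x : ℝ) (y : ℝ), y ≠ 0 → (x - y * Complex.I : ℂ) ≠ 0 := by
    intro x y hy h
    have := congrArg Complex.im h
    simp at this
    exact hy this
  have hexp1 : ∀ x : ℝ, Complex.exp (x - Real.pi * Complex.I) = -(Real.exp x : ℂ) := by
    intro x
    rw [Complex.exp_sub, Complex.exp_pi_mul_I]
    push_cast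
    ring
  have hexp2 : ∀ x : ℝ, Complex.exp (x - (-Real.pi : ℝ) * Complex.I) = -(Real.exp x : ℂ) := by
    intro x
    rw [Complex.ofReal_neg, neg_mul, sub_neg_eq_add, Complex.exp_add, Complex.exp_pi_mul_I]
    push_cast
    ring
  have key : ∫ x : ℝ, (d * (bernoulli.gen (x - Real.pi * Complex.I) *
        Complex.exp (-σ * (x - Real.pi * Complex.I))) -
      c * (bernoulli.gen (x - (-Real.pi : ℝ) * Complex.I) *
        Complex.exp (-σ * (x - (-Real.pi : ℝ) * Complex.I)))) =
      ∫ x : ℝ, (-(2 * Real.pi * Complex.I)) * ((Real.sigmoid x : ℂ) * Complex.exp (-σ * x)) := by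
    refine integral_congr_ae (ae_of_all _ fun x => ?_)
    have e1 : Complex.exp (-σ * (x - Real.pi * Complex.I)) = Complex.exp (-σ * x) * c := by
      rw [hc, ← Complex.exp_add]
      ring_nf
    have e2 : Complex.exp (-σ * (x - (-Real.pi : ℝ) * Complex.I)) = Complex.exp (-σ * x) * d := by
      rw [hd, ← Complex.exp_add]
      push_cast
      ring_nf
    simp only
    rw [bernoulli_gen_of_exp_eq_neg x (hne x _ hpi.ne') (hexp1 x),
      bernoulli_gen_of_exp_eq_neg x (hne x _ (neg_ne_zero.2 hpi.ne')) (hexp2 x), e1, e2]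
    push_cast
    linear_combination (-(2 * Real.pi * Complex.I) * Real.sigmoid x * Complex.exp (-σ * x)) * hcd
  rw [integral_sub (hint1.const_mul d) (hint2.const_mul c), integral_const_mul, integral_const_mul,
    integral_const_mul, ← hup, hdn, integral_sigmoid_mul_exp h0 h1] at key
  have hsin : c - d = 2 * Complex.I * Complex.sin (Real.pi * σ) := by
    rw [Complex.sin, ← hc, ← hd]
    linear_combination (c - d) * Complex.I_mul_I
  have hs := sin_pi_mul_ne_zero h0 h1
  have : J * Complex.sin (Real.pi * σ) = Real.pi * (Real.pi / Complex.sin (Real.pi * σ)) := by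
    have h2 : (2 * Complex.I) * (J * Complex.sin (Real.pi * σ)) =
        (2 * Complex.I) * (Real.pi * (Real.pi / Complex.sin (Real.pi * σ))) := by
      linear_combination (-1) * key - J * hsin
    exact mul_left_cancel₀ (by simp) h2
  rw [eq_div_of_mul_eq hs this]
  ring

/-- The kernel `(π / sin (π w)) ^ 2`, which is `√(2π)` times the Fourier transform of the Bernoulli
umbra at `-i w`. -/
def bernoulliKernel (w : ℂ) : ℂ := (Real.pi / Complex.sin (Real.pi * w)) ^ 2

lemma bernoulli_fourier {t : ℝ} (h0 : 0 < t) (h1 : t < 1) (x : ℝ) :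
    bernoulli.fourier (x - t * Complex.I) =
      (1 / (Real.sqrt (2 * Real.pi) : ℂ)) * bernoulliKernel (t + x * Complex.I) := by
  rw [Umbra.fourier, bernoulli_baseLine, bernoulliKernel,
    ← integral_bernoulli_gen_mul_exp (by simpa using h0) (by simpa using h1)]
  congr 1
  refine integral_congr_ae (ae_of_all _ fun y => ?_)
  simp only [Complex.ofReal_zero, zero_mul, sub_zero]
  congr 2
  linear_combination (t * y : ℂ) * Complex.I_mul_I

lemma bernoulli_evalIntegrand {t : ℝ} (h0 : 0 < t) (h1 : t < 1) (g : ℂ → ℂ) (x : ℝ) :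
    bernoulli.evalIntegrand g t x = (1 / (Real.sqrt (2 * Real.pi) : ℂ)) *
      (bernoulliKernel (t + x * Complex.I) * g (t + x * Complex.I)) := by
  rw [Umbra.evalIntegrand, bernoulli_fourier h0 h1, mul_assoc]
  congr 3
  linear_combination (-(t : ℂ)) * Complex.I_mul_I

/-! ### Moving the line of integration against the Bernoulli kernel -/

lemma sq_norm_sin_pi_mul (t x : ℝ) :
    ‖Complex.sin (Real.pi * (t + x * Complex.I))‖ ^ 2 =
      Real.sin (Real.pi * t) ^ 2 + Real.sinh (Real.pi * x) ^ 2 := by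
  have h : Complex.sin (Real.pi * (t + x * Complex.I)) =
      ((Real.sin (Real.pi * t) * Real.cosh (Real.pi * x) : ℝ) : ℂ) +
        ((Real.cos (Real.pi * t) * Real.sinh (Real.pi * x) : ℝ) : ℂ) * Complex.I := by
    rw [mul_add, ← mul_assoc, Complex.sin_add_mul_I]
    push_cast
    rfl
  rw [h, Complex.sq_norm, Complex.normSq_add_mul_I]
  have h1 := Real.cosh_sq (Real.pi * x)
  have h2 := Real.sin_sq_add_cos_sq (Real.pi * t)
  rw [mul_pow, mul_pow, h1]
  linear_combination Real.sinh (Real.pi * x) ^ 2 * h2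

lemma norm_bernoulliKernel (t x : ℝ) :
    ‖bernoulliKernel (t + x * Complex.I)‖ =
      Real.pi ^ 2 / (Real.sin (Real.pi * t) ^ 2 + Real.sinh (Real.pi * x) ^ 2) := by
  rw [bernoulliKernel, norm_pow, norm_div, div_pow, sq_norm_sin_pi_mul]
  simp

lemma norm_bernoulliKernel_le {t : ℝ} (h0 : 0 < t) (h1 : t < 1) (x : ℝ) :
    ‖bernoulliKernel (t + x * Complex.I)‖ ≤
      4 * Real.pi ^ 2 / Real.sin (Real.pi * t) ^ 2 * Real.exp (-(2 * Real.pi) * |x|) := by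
  have hs : 0 < Real.sin (Real.pi * t) := by
    apply Real.sin_pos_of_pos_of_lt_pi <;> nlinarith [Real.pi_pos]
  have hs1 : Real.sin (Real.pi * t) ^ 2 ≤ 1 := Real.sin_sq_le_one _
  have hcosh : Real.exp (2 * Real.pi * |x|) ≤ 4 * (1 + Real.sinh (Real.pi * x) ^ 2) := by
    have h2 : Real.exp (Real.pi * |x|) ≤ 2 * Real.cosh (Real.pi * x) := by
      rw [← Real.cosh_abs, abs_mul, abs_of_pos Real.pi_pos, Real.cosh_eq]
      linarith [Real.exp_pos (-(Real.pi * |x|))]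
    have h3 : Real.exp (2 * Real.pi * |x|) = Real.exp (Real.pi * |x|) ^ 2 := by
      rw [← Real.exp_nat_mul]
      ring_nf
    have h4 := Real.cosh_sq (Real.pi * x)
    rw [h3]
    nlinarith [Real.exp_pos (Real.pi * |x|)]
  have hden : Real.sin (Real.pi * t) ^ 2 * Real.exp (2 * Real.pi * |x|) ≤
      4 * (Real.sin (Real.pi * t) ^ 2 + Real.sinh (Real.pi * x) ^ 2) := by
    nlinarith [mul_le_mul_of_nonneg_left hcosh (sq_nonneg (Real.sin (Real.pi * t))),
      mul_nonneg (sub_nonneg.2 hs1) (sq_nonneg (Real.sinh (Real.pi * x)))]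
  rw [norm_bernoulliKernel, neg_mul, Real.exp_neg, ← div_eq_mul_inv, div_div,
    div_le_div_iff₀ (by positivity) (by positivity)]
  nlinarith [mul_le_mul_of_nonneg_left hden (sq_nonneg Real.pi)]

lemma norm_bernoulliKernel_le_one {w : ℂ} (hw : 1 ≤ |w.im|) : ‖bernoulliKernel w‖ ≤ 1 := by
  have h : w = w.re + w.im * Complex.I := (Complex.re_add_im w).symm
  have h1 : Real.pi ≤ |Real.sinh (Real.pi * w.im)| := by
    rw [Real.abs_sinh]
    refine le_trans ?_ (Real.self_le_sinh_iff.2 (abs_nonneg _))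
    rw [abs_mul, abs_of_pos Real.pi_pos]
    nlinarith [Real.pi_pos]
  have h2 : Real.pi ^ 2 ≤ Real.sinh (Real.pi * w.im) ^ 2 := by
    rw [← sq_abs (Real.sinh _)]
    exact pow_le_pow_left₀ Real.pi_pos.le h1 2
  rw [h, norm_bernoulliKernel]
  exact div_le_one_of_le₀ (by nlinarith [sq_nonneg (Real.sin (Real.pi * w.re))]) (by positivity)

lemma differentiableOn_bernoulliKernel :
    DifferentiableOn ℂ bernoulliKernel {w | 0 < w.re ∧ w.re < 1} := by
  unfold bernoulliKernel
  refine ((differentiableOn_const _).div (Differentiable.differentiableOn (by fun_prop))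
    fun w hw => sin_pi_mul_ne_zero hw.1 hw.2).pow 2

lemma continuous_bernoulliKernel_line {t : ℝ} (h0 : 0 < t) (h1 : t < 1) :
    Continuous fun x : ℝ => bernoulliKernel (t + x * Complex.I) :=
  differentiableOn_bernoulliKernel.continuousOn.comp_continuous (by fun_prop) fun x => by
    simpa using ⟨h0, h1⟩

lemma bernoulliKernel_add_one (w : ℂ) : bernoulliKernel (w + 1) = bernoulliKernel w := by
  rw [bernoulliKernel, bernoulliKernel, mul_add, mul_one, Complex.sin_add_pi, div_neg, neg_sq]

lemma integrable_bernoulliKernel_mul_pow {t : ℝ} (h0 : 0 < t) (h1 : t < 1) (j : ℕ) :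
    Integrable fun x : ℝ => bernoulliKernel (t + x * Complex.I) * (Complex.I * x) ^ j := by
  have hpi : 0 < 2 * Real.pi - 1 := by linarith [Real.pi_gt_three]
  refine ((integrable_exp_neg_mul_abs hpi).const_mul
    (4 * Real.pi ^ 2 / Real.sin (Real.pi * t) ^ 2 * j.factorial)).mono'
    ((continuous_bernoulliKernel_line h0 h1).mul (by fun_prop)).aestronglyMeasurable
    (ae_of_all _ fun x => ?_)
  have hx := Real.pow_div_factorial_le_exp |x| (abs_nonneg x) j
  rw [div_le_iff₀ (by positivity)] at hx
  rw [norm_mul, norm_pow, norm_mul, Complex.norm_I, one_mul, Complex.norm_real, Real.norm_eq_abs]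
  calc _ ≤ (4 * Real.pi ^ 2 / Real.sin (Real.pi * t) ^ 2 * Real.exp (-(2 * Real.pi) * |x|)) *
        (Real.exp |x| * j.factorial) :=
        mul_le_mul (norm_bernoulliKernel_le h0 h1 x) hx (by positivity) (by positivity)
    _ = 4 * Real.pi ^ 2 / Real.sin (Real.pi * t) ^ 2 * j.factorial *
        (Real.exp (-(2 * Real.pi) * |x|) * Real.exp |x|) := by ring
    _ = _ := by
        rw [← Real.exp_add]
        ring_nf

lemma integrable_bernoulliKernel {t : ℝ} (h0 : 0 < t) (h1 : t < 1) :
    Integrable fun x : ℝ => bernoulliKernel (t + x * Complex.I) := by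
  simpa using integrable_bernoulliKernel_mul_pow h0 h1 0

lemma integrable_bernoulliKernel_mul_affine {t : ℝ} (h0 : 0 < t) (h1 : t < 1) (a b c : ℂ) :
    Integrable fun x : ℝ =>
      bernoulliKernel (t + x * Complex.I) * (a + b * (c + x * Complex.I)) := by
  refine (((integrable_bernoulliKernel h0 h1).mul_const (a + b * c)).add
    ((integrable_bernoulliKernel_mul_pow h0 h1 1).mul_const b)).congr (ae_of_all _ fun x => ?_)
  simp only [Pi.add_apply]
  ring

lemma tendsto_cot_atTop (t : ℝ) :
    Tendsto (fun x : ℝ => Complex.cot (Real.pi * (t + x * Complex.I))) atTop (𝓝 (-Complex.I)) := by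
  have hq : Tendsto (fun x : ℝ => Complex.exp (2 * Complex.I * (Real.pi * (t + x * Complex.I))))
      atTop (𝓝 0) := by
    rw [tendsto_zero_iff_norm_tendsto_zero]
    have h : ∀ x : ℝ, ‖Complex.exp (2 * Complex.I * (Real.pi * (t + x * Complex.I)))‖ =
        Real.exp (-(2 * Real.pi * x)) := by
      intro x
      rw [Complex.norm_exp]
      congr 1
      simp
      ring
    simp only [h]
    exact Real.tendsto_exp_neg_atTop_nhds_zero.comp
      (tendsto_id.const_mul_atTop Real.two_pi_pos)
  simp only [Complex.cot_eq_exp_ratio]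
  have hl : (0 + 1) / (Complex.I * (1 - 0)) = -Complex.I := by simp
  rw [← hl]
  exact (hq.add_const 1).div ((hq.const_sub 1).const_mul Complex.I) (by simp)

lemma tendsto_cot_atBot (t : ℝ) :
    Tendsto (fun x : ℝ => Complex.cot (Real.pi * (t + x * Complex.I))) atBot (𝓝 Complex.I) := by
  have h := ((tendsto_cot_atTop (-t)).neg).comp tendsto_neg_atBot_atTop
  rw [neg_neg] at h
  refine h.congr fun x => ?_
  simp only [Function.comp]
  rw [show (Real.pi : ℂ) * (((-t : ℝ) : ℂ) + ((-x : ℝ) : ℂ) * Complex.I) =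
    -(Real.pi * (t + x * Complex.I)) by push_cast; ring, Complex.cot, Complex.cot, Complex.cos_neg,
    Complex.sin_neg, div_neg, neg_neg]

/-- The kernel has total mass `2 π`, since `-π cot (π w)` is a primitive. -/
lemma integral_bernoulliKernel {t : ℝ} (h0 : 0 < t) (h1 : t < 1) :
    ∫ x : ℝ, bernoulliKernel (t + x * Complex.I) = 2 * Real.pi := by
  have hderiv : ∀ x : ℝ, HasDerivAt
      (fun x : ℝ => Complex.I * Real.pi * Complex.cot (Real.pi * (t + x * Complex.I)))
      (bernoulliKernel (t + x * Complex.I)) x := by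
    intro x
    have hs : Complex.sin (Real.pi * (t + x * Complex.I)) ≠ 0 :=
      sin_pi_mul_ne_zero (by simpa using h0) (by simpa using h1)
    have hlin : HasDerivAt (fun x : ℝ => (Real.pi * (t + x * Complex.I) : ℂ))
        (Real.pi * (1 * Complex.I)) x :=
      ((((hasDerivAt_id x).ofReal_comp).mul_const Complex.I).const_add (t : ℂ)).const_mul _
    have h := ((((Complex.hasDerivAt_cos _).div (Complex.hasDerivAt_sin _) hs).comp x
      hlin).const_mul (Complex.I * Real.pi))
    refine h.congr_deriv ?_
    rw [bernoulliKernel, div_pow, mul_comm (Complex.I * (Real.pi : ℂ)), div_mul_eq_mul_div,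
      div_mul_eq_mul_div]
    congr 1
    have hsc := Complex.sin_sq_add_cos_sq (Real.pi * (t + x * Complex.I))
    linear_combination (-(Real.pi : ℂ) ^ 2 * Complex.I ^ 2) * hsc -
      (Real.pi : ℂ) ^ 2 * Complex.I_mul_I
  rw [integral_of_hasDerivAt_of_tendsto hderiv (integrable_bernoulliKernel h0 h1)
    ((tendsto_cot_atBot t).const_mul _) ((tendsto_cot_atTop t).const_mul _)]
  linear_combination (-(2 * Real.pi) : ℂ) * Complex.I_mul_I

/-- The evaluation at the Bernoulli umbra does not depend on the line in `0 < Re w < 1`. -/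
lemma integral_bernoulliKernel_mul_eq {g : ℂ → ℂ} {t u M s : ℝ} (h0 : 0 < t) (htu : t ≤ u)
    (h1 : u < 1) (hg : DifferentiableOn ℂ g {w | t ≤ w.re ∧ w.re ≤ u})
    (hbd : ∀ w : ℂ, t ≤ w.re → w.re ≤ u → ‖g w‖ ≤ M * Real.exp (s * |w.im|))
    (ht : Integrable fun x : ℝ => bernoulliKernel (t + x * Complex.I) * g (t + x * Complex.I))
    (hu : Integrable fun x : ℝ => bernoulliKernel (u + x * Complex.I) * g (u + x * Complex.I)) :
    ∫ x : ℝ, bernoulliKernel (t + x * Complex.I) * g (t + x * Complex.I) =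
      ∫ x : ℝ, bernoulliKernel (u + x * Complex.I) * g (u + x * Complex.I) := by
  refine integral_vertical_eq (g := fun w => bernoulliKernel w * g w) (M := M) (s := s) htu
    ((differentiableOn_bernoulliKernel.mono fun w hw => ?_).mul hg) (fun w hw1 hw2 hw3 => ?_) ht hu
  · have hw' : t ≤ w.re ∧ w.re ≤ u := hw
    exact ⟨h0.trans_le hw'.1, hw'.2.trans_lt h1⟩
  · rw [norm_mul]
    exact (mul_le_of_le_one_left (norm_nonneg _) (norm_bernoulliKernel_le_one hw3)).trans
      (hbd w hw1 hw2)

/-- Moving the line of integration by one crosses the double pole of the kernel at `1`, with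
residue `g' 1`. The residue is isolated by subtracting the affine part of `g` at `1`, which makes
the integrand analytic in the strip; the affine part contributes through the periodicity and the
total mass of the kernel. -/
lemma integral_bernoulliKernel_mul_add_one {g : ℂ → ℂ} {t M s : ℝ} (h0 : 0 < t) (h1 : t < 1)
    (hg : DifferentiableOn ℂ g {w | t ≤ w.re ∧ w.re ≤ t + 1})
    (hbd : ∀ w : ℂ, t ≤ w.re → w.re ≤ t + 1 → ‖g w‖ ≤ M * Real.exp (s * |w.im|))
    (ht : Integrable fun x : ℝ => bernoulliKernel (t + x * Complex.I) * g (t + x * Complex.I))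
    (ht1 : Integrable fun x : ℝ =>
      bernoulliKernel (t + x * Complex.I) * g (t + x * Complex.I + 1)) :
    (∫ x : ℝ, bernoulliKernel (t + x * Complex.I) * g (t + x * Complex.I + 1)) -
      ∫ x : ℝ, bernoulliKernel (t + x * Complex.I) * g (t + x * Complex.I) =
        2 * Real.pi * deriv g 1 := by
  set S : Set ℂ := {w | t ≤ w.re ∧ w.re ≤ t + 1} with hS
  have hS1 : S ∈ 𝓝 (1 : ℂ) := by
    have hopen : IsOpen {w : ℂ | t < w.re ∧ w.re < t + 1} :=
      (isOpen_lt continuous_const Complex.continuous_re).inter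
        (isOpen_lt Complex.continuous_re continuous_const)
    refine mem_of_superset (hopen.mem_nhds ?_) fun w hw => ⟨hw.1.le, hw.2.le⟩
    exact ⟨by simpa using h1, by simpa using h0⟩
  set σ : ℂ → ℂ := fun w => Complex.sin (Real.pi * w) / Real.pi with hσ
  have hσ1 : σ 1 = 0 := by simp [hσ]
  have hpi : (Real.pi : ℂ) ≠ 0 := by exact_mod_cast Real.pi_ne_zero
  have hdσ : HasDerivAt σ (-1) 1 := by
    have h := (((Complex.hasDerivAt_sin (Real.pi * 1)).comp (1 : ℂ)
      ((hasDerivAt_id (1 : ℂ)).const_mul (Real.pi : ℂ))).div_const (Real.pi : ℂ))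
    refine h.congr_deriv ?_
    rw [mul_one, Complex.cos_pi]
    field_simp
  have hSne : ∀ w ∈ S, dslope σ 1 w ≠ 0 := by
    intro w hw
    rcases eq_or_ne w 1 with rfl | hw1
    · simp [dslope_same, hdσ.deriv]
    · rw [dslope_of_ne _ hw1, slope_def_field, hσ1, sub_zero]
      refine div_ne_zero (div_ne_zero ?_ hpi) (sub_ne_zero.2 hw1)
      rw [Ne, Complex.sin_eq_zero_iff]
      rintro ⟨k, hk⟩
      rw [mul_comm, mul_left_inj' hpi] at hk
      have hw' : t ≤ w.re ∧ w.re ≤ t + 1 := hw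
      rw [hk, Complex.intCast_re] at hw'
      have e1 : (0 : ℝ) < k := h0.trans_le hw'.1
      have e2 : (k : ℝ) < 2 := by linarith [hw'.2]
      have e3 : 0 < k := by exact_mod_cast e1
      have e4 : k < 2 := by exact_mod_cast e2
      have e5 : k = 1 := by omega
      exact hw1 (by rw [hk, e5, Int.cast_one])
  set a := g 1 with ha
  set b := deriv g 1 with hb
  set h : ℂ → ℂ := fun w => dslope (dslope g 1) 1 w / dslope σ 1 w ^ 2 with hh
  have hval : ∀ w, w ≠ 1 → h w = bernoulliKernel w * (g w - (a + b * (w - 1))) := by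
    intro w hw
    have hw' := sub_ne_zero.2 hw
    simp only [hh]
    rw [dslope_of_ne _ hw, dslope_of_ne _ hw, slope_def_field, slope_def_field, dslope_same,
      dslope_of_ne _ hw, slope_def_field, hσ1, sub_zero, bernoulliKernel]
    simp only [hσ, ← ha, ← hb]
    rw [show (g w - a) / (w - 1) - b = (g w - (a + b * (w - 1))) / (w - 1) by field_simp; ring]
    rcases eq_or_ne (Complex.sin (Real.pi * w)) 0 with h2 | h2
    · simp [h2]
    · field_simp
  have hdiff : DifferentiableOn ℂ h S := by
    refine DifferentiableOn.div ?_ (DifferentiableOn.pow ?_ 2) fun w hw => pow_ne_zero 2 (hSne w hw)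
    · rwa [Complex.differentiableOn_dslope hS1, Complex.differentiableOn_dslope hS1]
    · rw [Complex.differentiableOn_dslope hS1]
      refine Differentiable.differentiableOn ?_
      simp only [hσ]
      fun_prop
  have hM : 0 ≤ M := by
    have h2 := (norm_nonneg _).trans (hbd 1 (by simpa using h1.le) (by simpa using h0.le))
    simpa using h2
  have hline : ∀ x : ℝ, h (t + x * Complex.I) = bernoulliKernel (t + x * Complex.I) *
      g (t + x * Complex.I) - bernoulliKernel (t + x * Complex.I) *
        (a + b * ((t - 1) + x * Complex.I)) := by
    intro x
    rw [hval]
    · ring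
    · intro h2
      have := congrArg Complex.re h2
      simp at this
      exact h1.ne this
  have hline1 : ∀ x : ℝ, h ((t + 1 : ℝ) + x * Complex.I) = bernoulliKernel (t + x * Complex.I) *
      g (t + x * Complex.I + 1) - bernoulliKernel (t + x * Complex.I) *
        (a + b * (t + x * Complex.I)) := by
    intro x
    rw [show (((t + 1 : ℝ) : ℂ) + x * Complex.I) = t + x * Complex.I + 1 by push_cast; ring, hval,
      bernoulliKernel_add_one]
    · ring
    · intro h2
      have := congrArg Complex.re h2
      simp at this
      exact h0.ne' this
  have hi0 := integrable_bernoulliKernel_mul_affine h0 h1 a b (t - 1)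
  have hi1 := integrable_bernoulliKernel_mul_affine h0 h1 a b t
  have key := integral_vertical_eq (g := h) (a := t) (b := t + 1)
    (M := M + (‖a‖ + ‖b‖)) (s := |s| + 1) (by linarith) hdiff ?_ ?_ ?_
  · simp only [hline, hline1] at key
    rw [integral_sub ht hi0, integral_sub ht1 hi1] at key
    have hdiff2 : (∫ x : ℝ, bernoulliKernel (t + x * Complex.I) * (a + b * (t + x * Complex.I))) -
        (∫ x : ℝ, bernoulliKernel (t + x * Complex.I) * (a + b * ((t - 1) + x * Complex.I))) =
          2 * Real.pi * b := by
      rw [← integral_sub hi1 hi0, ← integral_bernoulliKernel h0 h1, ← integral_mul_const]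
      refine integral_congr_ae (ae_of_all _ fun x => ?_)
      simp only
      ring
    linear_combination hdiff2 - key
  · intro w hw1 hw2 hw3
    have hne : w ≠ 1 := by
      rintro rfl
      norm_num at hw3
    rw [hval w hne, norm_mul]
    refine (mul_le_of_le_one_left (norm_nonneg _) (norm_bernoulliKernel_le_one hw3)).trans ?_
    refine (norm_sub_le _ _).trans ?_
    rw [add_mul]
    refine add_le_add ?_ ?_
    · refine (hbd w hw1 hw2).trans (mul_le_mul_of_nonneg_left (Real.exp_le_exp.2 ?_) hM)
      nlinarith [le_abs_self s, abs_nonneg w.im]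
    · have hexp : 1 + |w.im| ≤ Real.exp ((|s| + 1) * |w.im|) := by
        refine le_trans ?_ (Real.add_one_le_exp _)
        nlinarith [abs_nonneg s, abs_nonneg w.im, mul_nonneg (abs_nonneg s) (abs_nonneg w.im)]
      have hw4 : ‖w - 1‖ ≤ 1 + |w.im| := by
        refine (Complex.norm_le_abs_re_add_abs_im _).trans ?_
        simp only [Complex.sub_re, Complex.sub_im, Complex.one_re, Complex.one_im, sub_zero]
        gcongr
        rw [abs_le]
        constructor <;> linarith
      calc _ ≤ ‖a‖ + ‖b‖ * (1 + |w.im|) := by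
            refine (norm_add_le _ _).trans ?_
            rw [norm_mul]
            gcongr
        _ ≤ (‖a‖ + ‖b‖) * (1 + |w.im|) := by
            nlinarith [norm_nonneg a, norm_nonneg b, abs_nonneg w.im,
              mul_nonneg (norm_nonneg a) (abs_nonneg w.im),
              mul_nonneg (norm_nonneg b) (abs_nonneg w.im)]
        _ ≤ _ := by gcongr
  · simp only [hline]
    exact ht.sub hi0
  · simp only [hline1]
    exact ht1.sub hi1

/-! ### Primitives of functions of exponential type -/

lemma LocallyBoundedOn.exists_bound {C : ℝ → ℝ} {J K : Set ℝ} (hC : LocallyBoundedOn C J)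
    (hK : IsCompact K) (hKJ : K ⊆ J) : ∃ M, ∀ u ∈ K, |C u| ≤ M := by
  refine hK.induction_on (p := fun S => ∃ M, ∀ u ∈ S, |C u| ≤ M) ⟨0, by simp⟩ ?_ ?_ ?_
  · rintro S T hST ⟨M, hM⟩
    exact ⟨M, fun u hu => hM u (hST hu)⟩
  · rintro S T ⟨M, hM⟩ ⟨N, hN⟩
    refine ⟨max M N, ?_⟩
    rintro u (hu | hu)
    · exact (hM u hu).trans (le_max_left _ _)
    · exact (hN u hu).trans (le_max_right _ _)
  · intro t ht
    obtain ⟨M, hM⟩ := hC t (hKJ ht)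
    exact ⟨{u | |C u| ≤ M}, nhdsWithin_mono t hKJ hM, M, fun u hu => hu⟩

lemma IsExpTypeV.exists_bound {J : Set ℝ} {g : ℂ → ℂ} (hg : IsExpTypeV J g) {a b : ℝ}
    (hab : Set.Icc a b ⊆ J) :
    ∃ M s : ℝ, ∀ w : ℂ, a ≤ w.re → w.re ≤ b → ‖g w‖ ≤ M * Real.exp (s * |w.im|) := by
  obtain ⟨-, s, C, hC, hbd⟩ := hg
  obtain ⟨M, hM⟩ := hC.exists_bound isCompact_Icc hab
  refine ⟨M, s, fun w h1 h2 => (hbd w (hab ⟨h1, h2⟩)).trans ?_⟩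
  exact mul_le_mul_of_nonneg_right ((le_abs_self _).trans (hM _ ⟨h1, h2⟩)) (Real.exp_pos _).le

lemma IsExpTypeV.comp_add_right {g : ℂ → ℂ} (hg : IsExpTypeV (Set.Ioi 0) g) (z : ℂ) :
    IsExpTypeV (Set.Ioi (-z.re)) (fun w => g (w + z)) := by
  obtain ⟨hd, s, C, hC, hbd⟩ := hg
  have hmap : Set.MapsTo (fun u : ℝ => u + z.re) (Set.Ioi (-z.re)) (Set.Ioi 0) := by
    intro u hu
    simp only [Set.mem_Ioi] at hu ⊢
    linarith
  have hmem : ∀ w : ℂ, w ∈ vStrip (Set.Ioi (-z.re)) → w + z ∈ vStrip (Set.Ioi 0) := by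
    intro w hw
    simpa [vStrip] using hmap hw
  refine ⟨hd.comp (by fun_prop) hmem, |s|, fun u => |C (u + z.re)| * Real.exp (|s| * |z.im|),
    ?_, ?_⟩
  · intro t ht
    obtain ⟨M, hM⟩ := hC (t + z.re) (hmap ht)
    have hcont : Tendsto (fun u : ℝ => u + z.re) (𝓝[Set.Ioi (-z.re)] t)
        (𝓝[Set.Ioi 0] (t + z.re)) :=
      (continuous_id.add continuous_const).continuousWithinAt.tendsto_nhdsWithin hmap
    refine ⟨M * Real.exp (|s| * |z.im|), ?_⟩
    filter_upwards [hcont.eventually hM] with u hu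
    rw [abs_mul, abs_abs, Real.abs_exp]
    exact mul_le_mul_of_nonneg_right hu (Real.exp_pos _).le
  · intro w hw
    refine (hbd _ (hmem w hw)).trans ?_
    rw [mul_assoc, ← Real.exp_add, Complex.add_re, Complex.add_im]
    refine mul_le_mul (le_abs_self _) (Real.exp_le_exp.2 ?_) (Real.exp_pos _).le (abs_nonneg _)
    calc s * |w.im + z.im| ≤ |s| * (|w.im| + |z.im|) :=
          mul_le_mul (le_abs_self s) (abs_add_le _ _) (abs_nonneg _) (abs_nonneg _)
      _ = _ := by ring

lemma add_I_mul_mem_rightHalfPlane {T : ℂ} (hT : 0 < T.re) (x : ℝ) :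
    T + Complex.I * x ∈ rightHalfPlane := by
  simpa [rightHalfPlane] using hT

lemma continuous_vertical {f : ℂ → ℂ} (hf : ContinuousOn f rightHalfPlane) {T : ℂ}
    (hT : 0 < T.re) : Continuous fun x : ℝ => f (T + Complex.I * x) :=
  hf.comp_continuous (by fun_prop) (add_I_mul_mem_rightHalfPlane hT)

lemma IsPrimitive.differentiableOn {f F : ℂ → ℂ} (hF : IsPrimitive f F) :
    DifferentiableOn ℂ F rightHalfPlane :=
  fun w hw => (hF w hw).differentiableAt.differentiableWithinAt

lemma IsPrimitive.sub_eq_integral {f F : ℂ → ℂ} (hF : IsPrimitive f F)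
    (hf : ContinuousOn f rightHalfPlane) {T : ℂ} (hT : 0 < T.re) (x : ℝ) :
    F (T + Complex.I * x) - F T = Complex.I * ∫ η in (0 : ℝ)..x, f (T + Complex.I * η) := by
  have hderiv : ∀ η : ℝ, HasDerivAt (fun η : ℝ => F (T + Complex.I * η))
      (Complex.I * f (T + Complex.I * η)) η := by
    intro η
    have hlin : HasDerivAt (fun η : ℝ => (T + Complex.I * η : ℂ)) (Complex.I * 1) η :=
      (((hasDerivAt_id η).ofReal_comp).const_mul Complex.I).const_add T
    refine ((hF _ (add_I_mul_mem_rightHalfPlane hT η)).comp η hlin).congr_deriv ?_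
    ring
  have h := intervalIntegral.integral_eq_sub_of_hasDerivAt (a := 0) (b := x)
    (fun η _ => hderiv η)
    ((continuous_const.mul (continuous_vertical hf hT)).intervalIntegrable _ _)
  rw [← intervalIntegral.integral_const_mul, h]
  simp

theorem IsPrimitive.isExpTypeV {f F : ℂ → ℂ} (hF : IsPrimitive f F)
    (hf : IsExpTypeV (Set.Ioi 0) f) : IsExpTypeV (Set.Ioi 0) F := by
  obtain ⟨hd, s, C, hC, hbd⟩ := hf
  have hcont : ContinuousOn f rightHalfPlane := hd.continuousOn
  refine ⟨hF.differentiableOn, |s| + 1, fun u => ‖F u‖ + |C u|, ?_, ?_⟩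
  · intro t ht
    obtain ⟨M, hM⟩ := hC t ht
    have h1 : ContinuousAt (fun u : ℝ => ‖F u‖) t := by
      have h2 : ContinuousAt F (t : ℂ) := (hF t (by simpa [rightHalfPlane] using ht)).continuousAt
      exact (h2.comp (f := fun u : ℝ => (u : ℂ)) Complex.continuous_ofReal.continuousAt).norm
    refine ⟨‖F t‖ + 1 + M, ?_⟩
    filter_upwards [hM, nhdsWithin_le_nhds (h1.eventually_lt_const (lt_add_one ‖F t‖))] with u h2 h3
    rw [abs_of_nonneg (by positivity)]
    linarith
  · intro w hw
    have hre : 0 < (w.re : ℂ).re := by simpa using (show 0 < w.re from hw)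
    have hw1 : (w.re : ℂ) + Complex.I * w.im = w := by
      rw [mul_comm]
      exact Complex.re_add_im w
    have h := hF.sub_eq_integral hcont hre w.im
    rw [hw1, sub_eq_iff_eq_add'] at h
    have hint : ‖∫ η in (0 : ℝ)..w.im, f (w.re + Complex.I * η)‖ ≤
        |C w.re| * Real.exp (|s| * |w.im|) * |w.im - 0| := by
      refine intervalIntegral.norm_integral_le_of_norm_le_const fun η hη => ?_
      have hη' : |η| ≤ |w.im| := by
        rw [Set.uIoc, Set.mem_Ioc] at hη
        rcases le_total 0 w.im with h0 | h0
        · rw [min_eq_left h0, max_eq_right h0] at hη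
          rw [abs_of_nonneg h0, abs_of_pos hη.1]
          exact hη.2
        · rw [min_eq_right h0, max_eq_left h0] at hη
          rw [abs_of_nonpos h0, abs_of_nonpos hη.2]
          linarith [hη.1]
      refine (hbd _ (add_I_mul_mem_rightHalfPlane hre η)).trans ?_
      simp only [Complex.add_re, Complex.add_im, Complex.ofReal_re, Complex.ofReal_im,
        Complex.mul_re, Complex.mul_im, Complex.I_re, Complex.I_im, zero_mul, one_mul, zero_add,
        sub_zero, mul_zero, add_zero]
      refine mul_le_mul (le_abs_self _) (Real.exp_le_exp.2 ?_) (Real.exp_pos _).le (abs_nonneg _)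
      exact mul_le_mul (le_abs_self s) hη' (abs_nonneg _) (abs_nonneg _)
    rw [h]
    refine (norm_add_le _ _).trans ?_
    rw [norm_mul, Complex.norm_I, one_mul, add_mul]
    refine add_le_add ?_ (hint.trans ?_)
    · exact le_mul_of_one_le_right (norm_nonneg _) (Real.one_le_exp (by positivity))
    · rw [sub_zero, mul_assoc]
      refine mul_le_mul_of_nonneg_left ?_ (abs_nonneg _)
      rw [add_mul, one_mul, Real.exp_add]
      refine mul_le_mul_of_nonneg_left ?_ (Real.exp_pos _).le
      linarith [Real.add_one_le_exp |w.im|]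

/-! ### Weighted integrals along vertical lines -/

/-- The weight `exp (-2 π |x|)`, the order of decay of the Bernoulli kernel on vertical lines. -/
def expWeight (x : ℝ) : ENNReal := ENNReal.ofReal (Real.exp (-(2 * Real.pi) * |x|))

lemma measurable_expWeight : Measurable expWeight := by
  unfold expWeight
  fun_prop

lemma lintegral_indicator_expWeight_le (η : ℝ) :
    ∫⁻ x : ℝ, {x : ℝ | η ∈ Set.uIoc 0 x}.indicator expWeight x ≤
      ENNReal.ofReal (1 / (2 * Real.pi)) * expWeight η := by
  classical
  have hpi := Real.two_pi_pos
  rcases lt_or_ge 0 η with hη | hη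
  · calc _ ≤ ∫⁻ x : ℝ, (Set.Ici η).indicator
          (fun x => ENNReal.ofReal (Real.exp (-(2 * Real.pi) * x))) x := by
          refine lintegral_mono fun x => ?_
          rw [Set.indicator_apply, Set.indicator_apply]
          split_ifs with h1 h2
          · rw [Set.mem_Ici] at h2
            rw [expWeight, abs_of_pos (hη.trans_le h2)]
          · exfalso
            rw [Set.mem_ofPred_eq, Set.uIoc, Set.mem_Ioc] at h1
            rcases le_max_iff.1 h1.2 with h3 | h3
            · linarith
            · exact h2 h3
          · exact zero_le
          · exact le_rfl
      _ = _ := by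
          rw [lintegral_indicator measurableSet_Ici, ← setLIntegral_congr Ioi_ae_eq_Ici,
            ← ofReal_integral_eq_lintegral_ofReal
              (integrableOn_exp_mul_Ioi (neg_neg_of_pos hpi) η)
              (ae_of_all _ fun x => (Real.exp_pos _).le),
            integral_exp_mul_Ioi (neg_neg_of_pos hpi), expWeight, abs_of_pos hη,
            ← ENNReal.ofReal_mul (by positivity)]
          congr 1
          field_simp
  · calc _ ≤ ∫⁻ x : ℝ, (Set.Iic η).indicator
          (fun x => ENNReal.ofReal (Real.exp ((2 * Real.pi) * x))) x := by
          refine lintegral_mono fun x => ?_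
          rw [Set.indicator_apply, Set.indicator_apply]
          split_ifs with h1 h2
          · rw [Set.mem_Iic] at h2
            rw [expWeight, abs_of_nonpos (h2.trans hη), neg_mul_neg]
          · exfalso
            rw [Set.mem_ofPred_eq, Set.uIoc, Set.mem_Ioc] at h1
            rcases min_lt_iff.1 h1.1 with h3 | h3
            · linarith
            · exact h2 h3.le
          · exact zero_le
          · exact le_rfl
      _ = _ := by
          rw [lintegral_indicator measurableSet_Iic,
            ← ofReal_integral_eq_lintegral_ofReal (integrableOn_exp_mul_Iic hpi η)
              (ae_of_all _ fun x => (Real.exp_pos _).le),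
            integral_exp_mul_Iic hpi, expWeight, abs_of_nonpos hη, neg_mul_neg,
            ← ENNReal.ofReal_mul (by positivity)]
          congr 1
          field_simp

/-- By Tonelli's theorem, integration from `0` is bounded on the weighted space
`L¹(exp (-2 π |x|) dx)`. -/
lemma lintegral_intervalIntegral_mul_expWeight_le {r : ℝ → ℂ} (hr : Continuous r) :
    ∫⁻ x : ℝ, ‖∫ η in (0 : ℝ)..x, r η‖ₑ * expWeight x ≤
      ENNReal.ofReal (1 / (2 * Real.pi)) * ∫⁻ x : ℝ, ‖r x‖ₑ * expWeight x := by
  have hS : MeasurableSet {q : ℝ × ℝ | q.2 ∈ Set.uIoc 0 q.1} := by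
    have : {q : ℝ × ℝ | q.2 ∈ Set.uIoc 0 q.1} =
        {q | min 0 q.1 < q.2} ∩ {q | q.2 ≤ max 0 q.1} := rfl
    rw [this]
    exact (measurableSet_lt (by fun_prop) (by fun_prop)).inter
      (measurableSet_le (by fun_prop) (by fun_prop))
  calc _ ≤ ∫⁻ x : ℝ, ∫⁻ η : ℝ, {q : ℝ × ℝ | q.2 ∈ Set.uIoc 0 q.1}.indicator
        (fun q => ‖r q.2‖ₑ * expWeight q.1) (x, η) := by
        refine lintegral_mono fun x => ?_
        have h1 : ‖∫ η in (0 : ℝ)..x, r η‖ₑ ≤ ∫⁻ η in Set.uIoc 0 x, ‖r η‖ₑ := by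
          have h2 : ‖∫ η in (0 : ℝ)..x, r η‖ₑ = ‖∫ η in Set.uIoc 0 x, r η‖ₑ := by
            rw [← ofReal_norm, ← ofReal_norm, intervalIntegral.norm_intervalIntegral_eq]
          rw [h2]
          exact enorm_integral_le_lintegral_enorm _
        have hm : MeasurableSet (Set.uIoc 0 x) := measurableSet_uIoc
        calc _ ≤ (∫⁻ η in Set.uIoc 0 x, ‖r η‖ₑ) * expWeight x := by gcongr
          _ = ∫⁻ η in Set.uIoc 0 x, ‖r η‖ₑ * expWeight x :=
              (lintegral_mul_const _ (by fun_prop)).symm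
          _ = _ := by
              rw [← lintegral_indicator hm]
              rfl
    _ = ∫⁻ η : ℝ, ∫⁻ x : ℝ, {q : ℝ × ℝ | q.2 ∈ Set.uIoc 0 q.1}.indicator
        (fun q => ‖r q.2‖ₑ * expWeight q.1) (x, η) := by
        refine lintegral_lintegral_swap (Measurable.aemeasurable ?_)
        refine Measurable.indicator ?_ hS
        have := measurable_expWeight
        have := hr.measurable
        fun_prop
    _ ≤ ∫⁻ η : ℝ, ENNReal.ofReal (1 / (2 * Real.pi)) * (‖r η‖ₑ * expWeight η) := by
        refine lintegral_mono fun η => ?_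
        have h1 : ∀ x : ℝ, {q : ℝ × ℝ | q.2 ∈ Set.uIoc 0 q.1}.indicator
            (fun q => ‖r q.2‖ₑ * expWeight q.1) (x, η) =
              ‖r η‖ₑ * {x : ℝ | η ∈ Set.uIoc 0 x}.indicator expWeight x := by
          intro x
          by_cases h : η ∈ Set.uIoc 0 x <;> simp [Set.indicator, h]
        have hm : MeasurableSet {x : ℝ | η ∈ Set.uIoc 0 x} :=
          measurable_prodMk_right hS
        simp only [h1]
        rw [lintegral_const_mul _ (measurable_expWeight.indicator hm), mul_left_comm]
        gcongr
        exact lintegral_indicator_expWeight_le η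
    _ = _ := lintegral_const_mul _ (hr.measurable.enorm.mul measurable_expWeight)

lemma lintegral_eq_Ioi_add_Iio (φ : ℝ → ENNReal) :
    ∫⁻ x, φ x = (∫⁻ x in Set.Ioi 0, φ x) + ∫⁻ x in Set.Iio 0, φ x := by
  rw [← lintegral_add_compl φ (measurableSet_Ioi (a := (0 : ℝ))), Set.compl_Ioi,
    setLIntegral_congr Iio_ae_eq_Iic]

lemma MemHierarchy.lintegral_lt_top {p : ℕ} {f : ℂ → ℂ}
    (hf : MemHierarchy (-(2 * Real.pi)) 0 (2 * Real.pi) 0 p f) {T : ℂ} (hT : 0 < T.re) :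
    ∫⁻ x : ℝ, ‖f (T + Complex.I * x)‖ₑ * expWeight x < ⊤ := by
  have h1 := (hf.1.1 T hT).hasFiniteIntegral
  have h2 := (hf.2.1.1 T hT).hasFiniteIntegral
  rw [lintegral_eq_Ioi_add_Iio, ENNReal.add_lt_top]
  constructor
  · refine lt_of_eq_of_lt (setLIntegral_congr_fun measurableSet_Ioi fun x hx => ?_) h1
    have hx' : 0 < x := hx
    simp only [Real.rpow_zero, mul_one, enorm_mul, enorm_norm, expWeight, abs_of_pos hx']
    rw [Real.enorm_eq_ofReal (Real.exp_pos _).le]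
  · refine lt_of_eq_of_lt (setLIntegral_congr_fun measurableSet_Iio fun x hx => ?_) h2
    have hx' : x < 0 := hx
    simp only [Real.rpow_zero, mul_one, enorm_mul, enorm_norm, expWeight, abs_of_neg hx']
    rw [Real.enorm_eq_ofReal (Real.exp_pos _).le, neg_mul_neg, neg_neg]

lemma MemHierarchy.eventually_lintegral_taylorRem_le {p : ℕ} {f : ℂ → ℂ}
    (hf : MemHierarchy (-(2 * Real.pi)) 0 (2 * Real.pi) 0 p f) (R : ℝ) {ε : ℝ} (hε : 0 < ε) :
    ∀ᶠ X : ℝ in atTop, ∀ y : ℝ, |y| ≤ R →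
      ∫⁻ x : ℝ, ‖taylorRem p f (X + y * Complex.I) x‖ₑ * expWeight x ≤ ENNReal.ofReal ε := by
  filter_upwards [hf.1.2 R (ε / 2) (half_pos hε), hf.2.1.2 R (ε / 2) (half_pos hε)]
    with X h1 h2 y hy
  rw [lintegral_eq_Ioi_add_Iio, ← add_halves ε, ENNReal.ofReal_add (by positivity) (by positivity)]
  refine add_le_add (le_of_eq_of_le ?_ (h1 y hy)) (le_of_eq_of_le ?_ (h2 y hy))
  · refine setLIntegral_congr_fun measurableSet_Ioi fun x hx => ?_
    have hx' : 0 < x := hx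
    simp only [Real.rpow_zero, mul_one, expWeight, abs_of_pos hx']
  · refine setLIntegral_congr_fun measurableSet_Iio fun x hx => ?_
    have hx' : x < 0 := hx
    simp only [Real.rpow_zero, mul_one, expWeight, abs_of_neg hx', neg_mul_neg, neg_neg]

/-! ### Values at the Bernoulli umbra -/

lemma lintegral_bernoulliKernel_mul_le {t : ℝ} (h0 : 0 < t) (h1 : t < 1) (r : ℝ → ℂ) :
    ∫⁻ x : ℝ, ‖bernoulliKernel (t + x * Complex.I) * r x‖ₑ ≤
      ENNReal.ofReal (4 * Real.pi ^ 2 / Real.sin (Real.pi * t) ^ 2) *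
        ∫⁻ x : ℝ, ‖r x‖ₑ * expWeight x := by
  rw [← lintegral_const_mul' _ _ ENNReal.ofReal_ne_top]
  refine lintegral_mono fun x => ?_
  rw [enorm_mul, mul_comm ‖r x‖ₑ, ← mul_assoc, expWeight, ← ENNReal.ofReal_mul (by positivity)]
  gcongr
  rw [← ofReal_norm]
  exact ENNReal.ofReal_le_ofReal (norm_bernoulliKernel_le h0 h1 x)

/-- `F(B + z)`, computed on the line `Re w = t`. -/
def bernoulliLineValue (F : ℂ → ℂ) (t : ℝ) (z : ℂ) : ℂ :=
  1 / (2 * Real.pi) *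
    ∫ x : ℝ, bernoulliKernel (t + x * Complex.I) * F (t + x * Complex.I + z)

/-- `F(B + z)` for `Re z > -1`, computed on the line through the midpoint of the interval
`(0, 1) ∩ (-Re z, ∞)`. -/
def bernoulliValue (F : ℂ → ℂ) (z : ℂ) : ℂ := bernoulliLineValue F ((1 + max 0 (-z.re)) / 2) z

lemma MemHierarchy.continuousOn {a k b l : ℝ} {p : ℕ} {f : ℂ → ℂ}
    (hf : MemHierarchy a k b l p f) : ContinuousOn f rightHalfPlane :=
  hf.2.2.1.continuousOn

section

variable {p : ℕ} {f F : ℂ → ℂ} {t : ℝ} {z : ℂ}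

lemma integrable_bernoulliKernel_mul_primitive
    (hf : MemHierarchy (-(2 * Real.pi)) 0 (2 * Real.pi) 0 p f) (hF : IsPrimitive f F)
    (h0 : 0 < t) (h1 : t < 1) (hz : 0 < t + z.re) :
    Integrable fun x : ℝ => bernoulliKernel (t + x * Complex.I) * F (t + x * Complex.I + z) := by
  have hT : 0 < (t + z : ℂ).re := by simpa using hz
  have hF' := hF.sub_eq_integral hf.continuousOn hT
  have hcont : Continuous fun x : ℝ => F (t + z + Complex.I * x) - F (t + z) :=
    (continuous_vertical hF.differentiableOn.continuousOn hT).sub continuous_const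
  have hint : Integrable fun x : ℝ => bernoulliKernel (t + x * Complex.I) *
      (F (t + z + Complex.I * x) - F (t + z)) := by
    refine ⟨((continuous_bernoulliKernel_line h0 h1).mul hcont).aestronglyMeasurable, ?_⟩
    refine (lintegral_bernoulliKernel_mul_le h0 h1 _).trans_lt
      (ENNReal.mul_lt_top ENNReal.ofReal_lt_top ?_)
    have h2 : ∀ x : ℝ, ‖F (t + z + Complex.I * x) - F (t + z)‖ₑ =
        ‖∫ η in (0 : ℝ)..x, f (t + z + Complex.I * η)‖ₑ := by
      intro x
      rw [hF', enorm_mul, ← ofReal_norm Complex.I, Complex.norm_I, ENNReal.ofReal_one, one_mul]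
    simp only [h2]
    exact (lintegral_intervalIntegral_mul_expWeight_le
      (continuous_vertical hf.continuousOn hT)).trans_lt
        (ENNReal.mul_lt_top ENNReal.ofReal_lt_top (hf.lintegral_lt_top hT))
  refine (hint.add ((integrable_bernoulliKernel h0 h1).mul_const (F (t + z)))).congr
    (ae_of_all _ fun x => ?_)
  simp only [Pi.add_apply]
  rw [show (t + x * Complex.I + z : ℂ) = t + z + Complex.I * x by ring]
  ring

lemma bernoulliLineValue_eq_of_le
    (hf : MemHierarchy (-(2 * Real.pi)) 0 (2 * Real.pi) 0 p f) (hF : IsPrimitive f F) {u : ℝ}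
    (h0 : 0 < t) (htu : t ≤ u) (h1 : u < 1) (hz : 0 < t + z.re) :
    bernoulliLineValue F t z = bernoulliLineValue F u z := by
  have hg := (hF.isExpTypeV hf.2.2).comp_add_right z
  have hsub : Set.Icc t u ⊆ Set.Ioi (-z.re) := fun v hv => by
    simp only [Set.mem_Ioi]
    linarith [hv.1]
  obtain ⟨M, s, hM⟩ := hg.exists_bound hsub
  rw [bernoulliLineValue, bernoulliLineValue]
  congr 1
  exact integral_bernoulliKernel_mul_eq (g := fun w => F (w + z)) h0 htu h1
    (hg.1.mono fun w hw => hsub hw) hM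
    (integrable_bernoulliKernel_mul_primitive hf hF h0 (htu.trans_lt h1) hz)
    (integrable_bernoulliKernel_mul_primitive hf hF (h0.trans_le htu) h1 (by linarith))

lemma bernoulliLineValue_eq
    (hf : MemHierarchy (-(2 * Real.pi)) 0 (2 * Real.pi) 0 p f) (hF : IsPrimitive f F)
    (h0 : 0 < t) (h1 : t < 1) (hz : 0 < t + z.re) :
    bernoulliLineValue F t z = bernoulliValue F z := by
  rw [bernoulliValue]
  have hm0 := le_max_left 0 (-z.re)
  have hm1 : max 0 (-z.re) < 1 := max_lt one_pos (by linarith)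
  have hm2 := le_max_right 0 (-z.re)
  rcases le_total t ((1 + max 0 (-z.re)) / 2) with h | h
  · exact bernoulliLineValue_eq_of_le hf hF h0 h (by linarith) hz
  · exact (bernoulliLineValue_eq_of_le hf hF (by linarith) h h1 (by linarith)).symm

theorem hasEval_bernoulliValue
    (hf : MemHierarchy (-(2 * Real.pi)) 0 (2 * Real.pi) 0 p f) (hF : IsPrimitive f F)
    (hz : -1 < z.re) :
    bernoulli.HasEval (Set.Ioi (-z.re)) (fun w => F (w + z)) (bernoulliValue F z) := by
  refine ⟨⟨bernoulli_isRegular, isOpen_Ioi, Set.ordConnected_Ioi, ?_,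
    (hF.isExpTypeV hf.2.2).comp_add_right z, ?_⟩, ?_⟩
  · rw [bernoulli_regInterval]
    obtain ⟨t, ht1, ht2⟩ := exists_between (max_lt one_pos (by linarith : -z.re < 1))
    exact ⟨t, (le_max_right _ _).trans_lt ht1, (le_max_left _ _).trans_lt ht1, ht2⟩
  · rintro t ⟨htz, ht⟩
    rw [bernoulli_regInterval] at ht
    have htz' : 0 < t + z.re := by linarith [Set.mem_Ioi.1 htz]
    refine ((integrable_bernoulliKernel_mul_primitive hf hF ht.1 ht.2 htz').const_mul
      (1 / (Real.sqrt (2 * Real.pi) : ℂ))).congr (ae_of_all _ fun x => ?_)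
    exact (bernoulli_evalIntegrand ht.1 ht.2 (fun w => F (w + z)) x).symm
  · rintro t ⟨htz, ht⟩
    rw [bernoulli_regInterval] at ht
    have htz' : 0 < t + z.re := by linarith [Set.mem_Ioi.1 htz]
    rw [← bernoulliLineValue_eq hf hF ht.1 ht.2 htz', bernoulliLineValue]
    simp only [bernoulli_evalIntegrand ht.1 ht.2]
    rw [integral_const_mul, ← mul_assoc]
    congr 1
    rw [div_mul_div_comm, one_mul, ← Complex.ofReal_mul, Real.mul_self_sqrt Real.two_pi_pos.le]
    push_cast
    rfl

/-- The difference equation `F(B + z + 1) - F(B + z) = f (z + 1)`. -/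
theorem bernoulliValue_add_one_sub
    (hf : MemHierarchy (-(2 * Real.pi)) 0 (2 * Real.pi) 0 p f) (hF : IsPrimitive f F)
    (hz : -1 < z.re) : bernoulliValue F (z + 1) - bernoulliValue F z = f (z + 1) := by
  obtain ⟨t, ht1, h1⟩ := exists_between (max_lt one_pos (by linarith : -z.re < 1))
  have h0 : 0 < t := (le_max_left _ _).trans_lt ht1
  have hz0 : 0 < t + z.re := by linarith [(le_max_right 0 (-z.re)).trans_lt ht1]
  have hz1 : 0 < t + (z + 1).re := by
    rw [Complex.add_re, Complex.one_re]
    linarith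
  have hg := (hF.isExpTypeV hf.2.2).comp_add_right z
  have hsub : Set.Icc t (t + 1) ⊆ Set.Ioi (-z.re) := fun v hv => by
    simp only [Set.mem_Ioi]
    linarith [hv.1]
  obtain ⟨M, s, hM⟩ := hg.exists_bound hsub
  have hshift : ∀ x : ℝ, (t + x * Complex.I + (z + 1) : ℂ) = t + x * Complex.I + 1 + z := by
    intro x
    ring
  have hint := integrable_bernoulliKernel_mul_primitive hf hF h0 h1 hz1
  simp only [hshift] at hint
  have h := integral_bernoulliKernel_mul_add_one (g := fun w => F (w + z)) h0 h1
    (hg.1.mono fun w hw => hsub hw) hM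
    (integrable_bernoulliKernel_mul_primitive hf hF h0 h1 hz0) hint
  have hderiv : deriv (fun w => F (w + z)) 1 = f (z + 1) := by
    rw [deriv_comp_add_const, add_comm]
    exact (hF _ (by simpa [rightHalfPlane] using by linarith)).deriv
  rw [hderiv] at h
  rw [← bernoulliLineValue_eq hf hF h0 h1 hz1, ← bernoulliLineValue_eq hf hF h0 h1 hz0,
    bernoulliLineValue, bernoulliLineValue, ← mul_sub]
  simp only [hshift]
  rw [h, ← mul_assoc, one_div_mul_cancel (by simp [Real.pi_ne_zero]), one_mul]

/-! ### Asymptotic expansion of the values -/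

lemma iteratedDeriv_succ_primitive (hF : IsPrimitive f F) (j : ℕ) {w : ℂ}
    (hw : w ∈ rightHalfPlane) : iteratedDeriv (j + 1) F w = iteratedDeriv j f w := by
  rw [iteratedDeriv_succ']
  refine Filter.EventuallyEq.iteratedDeriv_eq j ?_
  filter_upwards [isOpen_rightHalfPlane.mem_nhds hw] with v hv using (hF v hv).deriv

/-- The Taylor remainders of a primitive are the integrals of those of the function. -/
lemma taylorRem_primitive (hF : IsPrimitive f F) (hf : ContinuousOn f rightHalfPlane) (p : ℕ)
    {T : ℂ} (hT : 0 < T.re) (x : ℝ) :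
    taylorRem (p + 1) F T x = Complex.I * ∫ η in (0 : ℝ)..x, taylorRem p f T η := by
  have hT' : T ∈ rightHalfPlane := hT
  have hpow : ∀ j : ℕ, Complex.I * ∫ η in (0 : ℝ)..x, (Complex.I * η) ^ j =
      (Complex.I * x) ^ (j + 1) / (j + 1) := by
    intro j
    have h : ∫ η in (0 : ℝ)..x, (η : ℂ) ^ j = (x : ℂ) ^ (j + 1) / (j + 1) := by
      have h := congrArg Complex.ofReal (integral_pow (a := 0) (b := x) j)
      rw [← intervalIntegral.integral_ofReal] at h
      simpa using h
    simp only [mul_pow]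
    rw [intervalIntegral.integral_const_mul, h, pow_succ Complex.I]
    ring
  simp only [taylorRem]
  rw [intervalIntegral.integral_sub ((continuous_vertical hf hT).intervalIntegrable _ _)
    (Continuous.intervalIntegrable (by fun_prop) _ _), mul_sub, ← hF.sub_eq_integral hf hT,
    intervalIntegral.integral_finsetSum
      (fun j _ => Continuous.intervalIntegrable (by fun_prop) _ _),
    Finset.sum_range_succ', Finset.mul_sum]
  have hsum : ∀ j ∈ Finset.range p, iteratedDeriv (j + 1) F T / ((j + 1).factorial : ℂ) *
      (Complex.I * x) ^ (j + 1) = Complex.I * ∫ η in (0 : ℝ)..x,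
        iteratedDeriv j f T / (j.factorial : ℂ) * (Complex.I * η) ^ j := by
    intro j _
    rw [intervalIntegral.integral_const_mul, mul_left_comm, hpow,
      iteratedDeriv_succ_primitive hF j hT', Nat.factorial_succ]
    have h1 : ((j : ℂ) + 1) ≠ 0 := by exact_mod_cast j.succ_ne_zero
    have h2 : (j.factorial : ℂ) ≠ 0 := by exact_mod_cast j.factorial_ne_zero
    push_cast
    field_simp
  rw [Finset.sum_congr rfl hsum]
  simp
  ring

lemma continuous_taylorRem (hf : ContinuousOn f rightHalfPlane) (p : ℕ) {T : ℂ} (hT : 0 < T.re) :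
    Continuous fun x : ℝ => taylorRem p f T x := by
  unfold taylorRem
  exact (continuous_vertical hf hT).sub (by fun_prop)

/-- The moments of the kernel on the line `Re w = 1 / 2`, normalized as Taylor coefficients. -/
def bernoulliMoment (j : ℕ) : ℂ :=
  1 / (2 * Real.pi) * ∫ x : ℝ, bernoulliKernel ((1 / 2 : ℝ) + x * Complex.I) *
    ((Complex.I * x) ^ j / (j.factorial : ℂ))

lemma norm_bernoulliLineValue_sub_le (hF : IsPrimitive f F)
    (hf : MemHierarchy (-(2 * Real.pi)) 0 (2 * Real.pi) 0 p f) {ε : ℝ} (hε : 0 ≤ ε)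
    (hz : 0 < 1 / 2 + z.re)
    (hrem : ∫⁻ x : ℝ, ‖taylorRem p f ((1 / 2 : ℝ) + z) x‖ₑ * expWeight x ≤ ENNReal.ofReal ε) :
    ‖bernoulliLineValue F (1 / 2) z - ∑ j ∈ Finset.range (p + 1),
      bernoulliMoment j * iteratedDeriv j F ((1 / 2 : ℝ) + z)‖ ≤ ε := by
  have h0 : (0 : ℝ) < 1 / 2 := by norm_num
  have h1 : (1 / 2 : ℝ) < 1 := by norm_num
  set T : ℂ := (1 / 2 : ℝ) + z with hTdef
  have hT : 0 < T.re := by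
    rw [hTdef, Complex.add_re, Complex.ofReal_re]
    exact hz
  have hint := integrable_bernoulliKernel_mul_primitive hf hF h0 h1 hz
  have hintj : ∀ j ∈ Finset.range (p + 1), Integrable fun x : ℝ =>
      bernoulliKernel ((1 / 2 : ℝ) + x * Complex.I) *
        ((Complex.I * x) ^ j / (j.factorial : ℂ)) * iteratedDeriv j F T := by
    intro j _
    refine ((integrable_bernoulliKernel_mul_pow h0 h1 j).mul_const
      (iteratedDeriv j F T / (j.factorial : ℂ))).congr (ae_of_all _ fun x => ?_)
    simp only
    ring
  have hval : bernoulliLineValue F (1 / 2) z - ∑ j ∈ Finset.range (p + 1),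
      bernoulliMoment j * iteratedDeriv j F T = 1 / (2 * Real.pi) *
        ∫ x : ℝ, bernoulliKernel ((1 / 2 : ℝ) + x * Complex.I) * taylorRem (p + 1) F T x := by
    simp only [bernoulliLineValue, bernoulliMoment, mul_assoc (1 / (2 * Real.pi) : ℂ)]
    rw [← Finset.mul_sum, ← mul_sub]
    congr 1
    simp only [← integral_mul_const]
    rw [← integral_finsetSum _ hintj, ← integral_sub hint (integrable_finsetSum _ hintj)]
    refine integral_congr_ae (ae_of_all _ fun x => ?_)
    simp only [taylorRem]
    rw [mul_sub, Finset.mul_sum,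
      show (((1 / 2 : ℝ) : ℂ) + x * Complex.I + z) = T + Complex.I * x by rw [hTdef]; ring]
    congr 1
    refine Finset.sum_congr rfl fun j _ => ?_
    ring
  have hbound : ‖∫ x : ℝ, bernoulliKernel ((1 / 2 : ℝ) + x * Complex.I) *
      taylorRem (p + 1) F T x‖ₑ ≤ ENNReal.ofReal (2 * Real.pi * ε) := by
    refine (enorm_integral_le_lintegral_enorm _).trans
      ((lintegral_bernoulliKernel_mul_le h0 h1 _).trans ?_)
    have h2 : ∀ x : ℝ, ‖taylorRem (p + 1) F T x‖ₑ = ‖∫ η in (0 : ℝ)..x, taylorRem p f T η‖ₑ := by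
      intro x
      rw [taylorRem_primitive hF hf.continuousOn p hT, enorm_mul, ← ofReal_norm Complex.I,
        Complex.norm_I, ENNReal.ofReal_one, one_mul]
    simp only [h2]
    have h3 : Real.sin (Real.pi * (1 / 2)) = 1 := by
      rw [mul_one_div, Real.sin_pi_div_two]
    calc _ ≤ ENNReal.ofReal (4 * Real.pi ^ 2 / Real.sin (Real.pi * (1 / 2)) ^ 2) *
          (ENNReal.ofReal (1 / (2 * Real.pi)) * ENNReal.ofReal ε) := by
          gcongr
          refine (lintegral_intervalIntegral_mul_expWeight_le
            (continuous_taylorRem hf.continuousOn p hT)).trans ?_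
          gcongr
      _ = _ := by
          rw [h3, ← ENNReal.ofReal_mul (by positivity), ← ENNReal.ofReal_mul (by positivity)]
          congr 1
          field_simp
          ring
  rw [← ofReal_norm, ENNReal.ofReal_le_ofReal_iff (by positivity)] at hbound
  rw [hval, norm_mul]
  have h4 : ‖(1 / (2 * Real.pi) : ℂ)‖ = 1 / (2 * Real.pi) := by
    rw [norm_div, norm_one, norm_mul, Complex.norm_ofNat, Complex.norm_real,
      Real.norm_of_nonneg Real.pi_pos.le]
  rw [h4, one_div_mul_eq_div, div_le_iff₀ Real.two_pi_pos, mul_comm ε]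
  exact hbound

lemma tendsto_bernoulliValue_sub (hF : IsPrimitive f F)
    (hf : MemHierarchy (-(2 * Real.pi)) 0 (2 * Real.pi) 0 p f) (y : ℂ) :
    Tendsto (fun n : ℕ => bernoulliValue F (n + y) - ∑ j ∈ Finset.range (p + 1),
      bernoulliMoment j * iteratedDeriv j F ((1 / 2 : ℝ) + n + y)) atTop (𝓝 0) := by
  rw [Metric.tendsto_atTop']
  intro ε hε
  obtain ⟨X, hX⟩ := eventually_atTop.1
    (hf.eventually_lintegral_taylorRem_le |y.im| (half_pos hε))
  obtain ⟨N, hN⟩ := exists_nat_ge (max (X - y.re) (-y.re))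
  refine ⟨N, fun n hn => ?_⟩
  have hn' : (N : ℝ) ≤ n := by exact_mod_cast hn.le
  have h1 := (le_max_left _ _).trans (hN.trans hn')
  have h2 := (le_max_right _ _).trans (hN.trans hn')
  have hz : 0 < 1 / 2 + (n + y : ℂ).re := by
    rw [Complex.add_re, Complex.natCast_re]
    linarith
  have hT : (((1 / 2 : ℝ) : ℂ) + (n + y)) =
      ((1 / 2 + n + y.re : ℝ) : ℂ) + (y.im : ℂ) * Complex.I := by
    conv_lhs => rw [← Complex.re_add_im y]
    push_cast
    ring
  have hrem := hX (1 / 2 + n + y.re) (by linarith) y.im le_rfl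
  rw [← hT] at hrem
  have h := norm_bernoulliLineValue_sub_le hF hf (half_pos hε).le hz hrem
  rw [bernoulliLineValue_eq hf hF (by norm_num) (by norm_num) hz] at h
  rw [dist_zero_right]
  simp only [add_assoc]
  exact h.trans_lt (half_lt_self hε)

end

/-- Taylor's inequality along the segment from `a` to `a + y`. -/
lemma norm_sub_taylor_le {U : Set ℂ} (hU : IsOpen U) {ε : ℝ} (m : ℕ) :
    ∀ {g : ℂ → ℂ}, DifferentiableOn ℂ g U → ∀ {a y : ℂ},
      (∀ s ∈ Set.Icc (0 : ℝ) 1, a + s * y ∈ U) →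
      (∀ s ∈ Set.Icc (0 : ℝ) 1, ‖iteratedDeriv m g (a + s * y)‖ ≤ ε) →
      ‖g (a + y) - ∑ i ∈ Finset.range m, iteratedDeriv i g a / (i.factorial : ℂ) * y ^ i‖ ≤
        ε * ‖y‖ ^ m := by
  induction m with
  | zero =>
    intro g _ a y _ hb
    simpa using hb 1 (by simp)
  | succ m ih =>
    intro g hg a y hseg hb
    have hg' : DifferentiableOn ℂ (deriv g) U := hg.deriv hU
    have hε : 0 ≤ ε := (norm_nonneg _).trans (hb 0 (by simp))
    set φ : ℝ → ℂ := fun s => g (a + s * y) - ∑ i ∈ Finset.range (m + 1),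
      iteratedDeriv i g a / (i.factorial : ℂ) * (s * y) ^ i with hφ
    set φ' : ℝ → ℂ := fun s => (deriv g (a + s * y) - ∑ i ∈ Finset.range m,
      iteratedDeriv i (deriv g) a / (i.factorial : ℂ) * (s * y) ^ i) * y with hφ'
    have hderiv : ∀ s ∈ Set.Icc (0 : ℝ) 1, HasDerivWithinAt φ (φ' s) (Set.Icc 0 1) s := by
      intro s hs
      have hlin : HasDerivAt (fun s : ℝ => (s * y : ℂ)) y s := by
        simpa using ((hasDerivAt_id s).ofReal_comp).mul_const y
      have h1 : HasDerivAt (fun s : ℝ => g (a + s * y)) (deriv g (a + s * y) * y) s :=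
        ((hg.differentiableAt (hU.mem_nhds (hseg s hs))).hasDerivAt).comp s (hlin.const_add a)
      have h2 : ∀ i ∈ Finset.range m, HasDerivAt (fun s : ℝ =>
          iteratedDeriv (i + 1) g a / ((i + 1).factorial : ℂ) * (s * y : ℂ) ^ (i + 1))
          (iteratedDeriv i (deriv g) a / (i.factorial : ℂ) * (s * y) ^ i * y) s := by
        intro i _
        refine ((hlin.pow (i + 1)).const_mul _).congr_deriv ?_
        rw [iteratedDeriv_succ', Nat.factorial_succ, Nat.add_sub_cancel]
        have h3 : ((i : ℂ) + 1) ≠ 0 := by exact_mod_cast i.succ_ne_zero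
        have h4 : (i.factorial : ℂ) ≠ 0 := by exact_mod_cast i.factorial_ne_zero
        push_cast
        field_simp
      have h5 := h1.sub ((HasDerivAt.fun_sum h2).add_const
        (iteratedDeriv 0 g a / ((0 : ℕ).factorial : ℂ)))
      refine HasDerivAt.hasDerivWithinAt ?_
      refine (h5.congr_of_eventuallyEq (Eventually.of_forall fun u => ?_)).congr_deriv ?_
      · simp only [hφ, Pi.sub_apply]
        rw [Finset.sum_range_succ']
        simp
      · rw [hφ', ← Finset.sum_mul]
        ring
    have hbound : ∀ s ∈ Set.Ico (0 : ℝ) 1, ‖φ' s‖ ≤ ε * ‖y‖ ^ m * ‖y‖ := by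
      intro s hs
      have hmul : ∀ u ∈ Set.Icc (0 : ℝ) 1, u * s ∈ Set.Icc (0 : ℝ) 1 := fun u hu =>
        ⟨mul_nonneg hu.1 hs.1, mul_le_one₀ hu.2 hs.1 hs.2.le⟩
      have h := ih hg' (a := a) (y := s * y)
        (fun u hu => by simpa [mul_assoc] using hseg _ (hmul u hu))
        (fun u hu => by
          have := hb _ (hmul u hu)
          rw [iteratedDeriv_succ'] at this
          simpa [mul_assoc] using this)
      rw [hφ', norm_mul]
      refine mul_le_mul_of_nonneg_right (h.trans ?_) (norm_nonneg _)
      refine mul_le_mul_of_nonneg_left (pow_le_pow_left₀ (norm_nonneg _) ?_ m) hε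
      rw [norm_mul, Complex.norm_real, Real.norm_of_nonneg hs.1]
      exact mul_le_of_le_one_left (norm_nonneg _) hs.2.le
    have h := norm_image_sub_le_of_norm_deriv_le_segment' hderiv hbound 1 (by simp)
    have hφ0 : φ 0 = 0 := by
      simp only [hφ, Finset.sum_range_succ']
      simp
    have hφ1 : φ 1 = g (a + y) - ∑ i ∈ Finset.range (m + 1),
        iteratedDeriv i g a / (i.factorial : ℂ) * y ^ i := by simp [hφ]
    rw [hφ0, sub_zero, hφ1, sub_zero, mul_one] at h
    rwa [pow_succ, ← mul_assoc]

section

variable {p : ℕ} {f F : ℂ → ℂ}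

lemma iteratedDeriv_iteratedDeriv (i j : ℕ) (g : ℂ → ℂ) :
    iteratedDeriv i (iteratedDeriv j g) = iteratedDeriv (i + j) g := by
  simp only [iteratedDeriv_eq_iterate, Function.iterate_add_apply]

lemma differentiableOn_iteratedDeriv {U : Set ℂ} (hU : IsOpen U) {g : ℂ → ℂ}
    (hg : DifferentiableOn ℂ g U) (j : ℕ) : DifferentiableOn ℂ (iteratedDeriv j g) U := by
  induction j with
  | zero => simpa using hg
  | succ j ih =>
    rw [iteratedDeriv_succ]
    exact ih.deriv hU

lemma tendsto_iteratedDeriv_sub_taylor (hF : IsPrimitive f F)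
    (hlim : TendstoLocallyUniformly
      (fun (t ξ : ℝ) => iteratedDeriv p f (t + Complex.I * ξ)) (fun _ => 0) atTop)
    {j m : ℕ} (hjm : m + j = p + 1) (y : ℂ) :
    Tendsto (fun n : ℕ => iteratedDeriv j F ((1 / 2 : ℝ) + n + y) - ∑ i ∈ Finset.range m,
      iteratedDeriv (i + j) F ((1 / 2 : ℝ) + n) / (i.factorial : ℂ) * y ^ i) atTop (𝓝 0) := by
  rw [Metric.tendsto_atTop']
  intro δ hδ
  set ε := δ / (‖y‖ ^ m + 1) with hεdef
  have hden : 0 < ‖y‖ ^ m + 1 := by positivity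
  have hε : 0 < ε := div_pos hδ hden
  have hunif := tendstoLocallyUniformly_iff_forall_isCompact.1 hlim _
    (isCompact_Icc (a := -|y.im|) (b := |y.im|))
  obtain ⟨X, hX⟩ := eventually_atTop.1 (Metric.tendstoUniformlyOn_iff.1 hunif ε hε)
  obtain ⟨N, hN⟩ := exists_nat_ge (max X 0 + |y.re|)
  refine ⟨N, fun n hn => ?_⟩
  have hn' : (N : ℝ) ≤ n := by exact_mod_cast hn.le
  have hre : ∀ s ∈ Set.Icc (0 : ℝ) 1, max X 0 < 1 / 2 + n + s * y.re := by
    intro s hs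
    have h1 : |s * y.re| ≤ |y.re| := by
      rw [abs_mul, abs_of_nonneg hs.1]
      exact mul_le_of_le_one_left (abs_nonneg _) hs.2
    linarith [neg_abs_le (s * y.re)]
  have hpt : ∀ s : ℝ, (((1 / 2 : ℝ) : ℂ) + n + s * y) =
      ((1 / 2 + n + s * y.re : ℝ) : ℂ) + Complex.I * ((s * y.im : ℝ) : ℂ) := by
    intro s
    conv_lhs => rw [← Complex.re_add_im y]
    push_cast
    ring
  have hmem : ∀ s ∈ Set.Icc (0 : ℝ) 1, ((1 / 2 : ℝ) : ℂ) + n + s * y ∈ rightHalfPlane := by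
    intro s hs
    rw [hpt]
    refine add_I_mul_mem_rightHalfPlane ?_ _
    rw [Complex.ofReal_re]
    exact (le_max_right _ _).trans_lt (hre s hs)
  have h := norm_sub_taylor_le (ε := ε) isOpen_rightHalfPlane m
    (differentiableOn_iteratedDeriv isOpen_rightHalfPlane hF.differentiableOn j) hmem
    fun s hs => by
      rw [iteratedDeriv_iteratedDeriv, hjm, iteratedDeriv_succ_primitive hF p (hmem s hs), hpt]
      have hs' : s * y.im ∈ Set.Icc (-|y.im|) |y.im| := by
        rw [Set.mem_Icc, ← abs_le, abs_mul, abs_of_nonneg hs.1]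
        exact mul_le_of_le_one_left (abs_nonneg _) hs.2
      have := hX _ ((le_max_left _ _).trans (hre s hs).le) _ hs'
      rw [dist_zero_left] at this
      exact this.le
  simp only [iteratedDeriv_iteratedDeriv] at h
  rw [dist_zero_right]
  refine h.trans_lt ?_
  rw [hεdef, div_mul_eq_mul_div, div_lt_iff₀ hden]
  nlinarith

/-! ### Fractional sums -/

/-- The polynomials in `y` that approximate `F(B + n + y) - F(B + n)`: Taylor expansion about
`n + 1 / 2`, first along the line of integration and then in the direction of `y`. -/
def bernoulliPoly (p : ℕ) (F : ℂ → ℂ) (n : ℕ) : Polynomial ℂ :=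
  ∑ j ∈ Finset.range (p + 1), Polynomial.C (bernoulliMoment j) *
    ((∑ i ∈ Finset.range (p + 1 - j),
      Polynomial.C (iteratedDeriv (i + j) F ((1 / 2 : ℝ) + n) / (i.factorial : ℂ)) *
        Polynomial.X ^ i) - Polynomial.C (iteratedDeriv j F ((1 / 2 : ℝ) + n)))

lemma natDegree_bernoulliPoly_le (p : ℕ) (F : ℂ → ℂ) (n : ℕ) :
    (bernoulliPoly p F n).natDegree ≤ p + 1 := by
  refine Polynomial.natDegree_sum_le_of_forall_le _ _ fun j _ => ?_
  refine (Polynomial.natDegree_C_mul_le _ _).trans ((Polynomial.natDegree_sub_le _ _).trans ?_)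
  refine max_le (Polynomial.natDegree_sum_le_of_forall_le _ _ fun i hi => ?_) ?_
  · refine (Polynomial.natDegree_C_mul_X_pow_le _ _).trans ?_
    have := Finset.mem_range.1 hi
    omega
  · simp

lemma eval_bernoulliPoly (p : ℕ) (F : ℂ → ℂ) (n : ℕ) (y : ℂ) :
    (bernoulliPoly p F n).eval y = ∑ j ∈ Finset.range (p + 1), bernoulliMoment j *
      ((∑ i ∈ Finset.range (p + 1 - j),
        iteratedDeriv (i + j) F ((1 / 2 : ℝ) + n) / (i.factorial : ℂ) * y ^ i) -
          iteratedDeriv j F ((1 / 2 : ℝ) + n)) := by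
  simp [bernoulliPoly, Polynomial.eval_finsetSum]

lemma tendsto_bernoulliValue_sub_eval (hF : IsPrimitive f F)
    (hf : MemHierarchy (-(2 * Real.pi)) 0 (2 * Real.pi) 0 p f)
    (hlim : TendstoLocallyUniformly
      (fun (t ξ : ℝ) => iteratedDeriv p f (t + Complex.I * ξ)) (fun _ => 0) atTop) (y : ℂ) :
    Tendsto (fun n : ℕ => bernoulliValue F (n + y) - bernoulliValue F n -
      (bernoulliPoly p F n).eval y) atTop (𝓝 0) := by
  have h1 := tendsto_bernoulliValue_sub hF hf y
  have h2 := tendsto_bernoulliValue_sub hF hf 0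
  have h3 : Tendsto (fun n : ℕ => ∑ j ∈ Finset.range (p + 1), bernoulliMoment j *
      (iteratedDeriv j F ((1 / 2 : ℝ) + n + y) - ∑ i ∈ Finset.range (p + 1 - j),
        iteratedDeriv (i + j) F ((1 / 2 : ℝ) + n) / (i.factorial : ℂ) * y ^ i)) atTop
      (𝓝 (∑ j ∈ Finset.range (p + 1), bernoulliMoment j * 0)) := by
    refine tendsto_finsetSum _ fun j hj => ?_
    have hj' := Finset.mem_range.1 hj
    exact (tendsto_iteratedDeriv_sub_taylor hF hlim (by omega) y).const_mul _
  have h := (h1.sub h2).add h3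
  simp only [add_zero, mul_zero, Finset.sum_const_zero, sub_zero] at h
  refine h.congr fun n => ?_
  rw [eval_bernoulliPoly]
  simp only [mul_sub, Finset.sum_sub_distrib]
  ring

lemma sum_sub_eq_bernoulliValue (hF : IsPrimitive f F)
    (hf : MemHierarchy (-(2 * Real.pi)) 0 (2 * Real.pi) 0 p f) {y : ℂ} (hy : -1 < y.re) (n : ℕ) :
    ∑ k ∈ Finset.Icc 1 n, (f (k + y) - f k) =
      (bernoulliValue F (n + y) - bernoulliValue F n) -
        (bernoulliValue F y - bernoulliValue F 0) := by
  induction n with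
  | zero => simp
  | succ n ih =>
    have hn : (0 : ℝ) ≤ n := n.cast_nonneg
    rw [Finset.sum_Icc_succ_top (by omega), ih]
    have h1 := bernoulliValue_add_one_sub hf hF (z := n + y) (by
      rw [Complex.add_re, Complex.natCast_re]
      linarith)
    have h2 := bernoulliValue_add_one_sub hf hF (z := n) (by
      rw [Complex.natCast_re]
      linarith)
    push_cast
    rw [add_right_comm (n : ℂ) 1 y, ← h1, ← h2]
    ring

theorem isMSAntidifference_bernoulliValue (hF : IsPrimitive f F)
    (hf : MemHierarchy (-(2 * Real.pi)) 0 (2 * Real.pi) 0 p f)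
    (hlim : TendstoLocallyUniformly
      (fun (t ξ : ℝ) => iteratedDeriv p f (t + Complex.I * ξ)) (fun _ => 0) atTop) :
    IsMSAntidifference rightHalfPlane f fun y => bernoulliValue F y - bernoulliValue F 0 := by
  have hre : ∀ y : ℂ, y + 1 ∈ rightHalfPlane → -1 < y.re := by
    intro y hy
    have h : 0 < (y + 1).re := hy
    rw [Complex.add_re, Complex.one_re] at h
    linarith
  refine ⟨bernoulliPoly p F, ⟨p + 1, natDegree_bernoulliPoly_le p F⟩, fun y hy => ?_,
    fun y hy => ?_⟩
  · have h := (tendsto_bernoulliValue_sub_eval hF hf hlim y).sub_const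
      (bernoulliValue F y - bernoulliValue F 0)
    rw [zero_sub] at h
    refine h.congr fun n => ?_
    rw [sum_sub_eq_bernoulliValue hF hf (hre y hy)]
    ring
  · rw [sub_sub_sub_cancel_right]
    exact bernoulliValue_add_one_sub hf hF (hre y hy)

end

/-- A pointwise limit of polynomials of bounded degree that is constant on `ℕ` has the same value
wherever it exists: by Lagrange interpolation, its values are determined by those on finitely many natural
numbers. -/
lemma eq_of_tendsto_eval {P : ℕ → Polynomial ℂ} {d : ℕ} (hd : ∀ n, (P n).natDegree ≤ d)
    {D : ℂ} (hnat : ∀ i : ℕ, Tendsto (fun n => (P n).eval (i : ℂ)) atTop (𝓝 D)) {y L : ℂ}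
    (hy : Tendsto (fun n => (P n).eval y) atTop (𝓝 L)) : L = D := by
  set s := Finset.range (d + 1)
  set v : ℕ → ℂ := fun i => i
  have hv : Set.InjOn v s := Nat.cast_injective.injOn
  have hP : ∀ n, (P n).eval y = ∑ i ∈ s, (P n).eval (v i) * (Lagrange.basis s v i).eval y := by
    intro n
    have hdeg : (P n).degree < s.card := by
      rw [Finset.card_range]
      exact Polynomial.degree_le_natDegree.trans_lt (by exact_mod_cast Nat.lt_succ_of_le (hd n))
    conv_lhs => rw [Lagrange.eq_interpolate hv hdeg, Lagrange.interpolate_apply]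
    simp [Polynomial.eval_finsetSum]
  have hone : ∑ i ∈ s, (Lagrange.basis s v i).eval y = 1 := by
    rw [← Polynomial.eval_finsetSum, Lagrange.sum_basis hv ⟨0, by simp [s]⟩, Polynomial.eval_one]
  have hlim : Tendsto (fun n => (P n).eval y) atTop
      (𝓝 (∑ i ∈ s, D * (Lagrange.basis s v i).eval y)) := by
    simp only [hP]
    exact tendsto_finsetSum _ fun i _ => (hnat i).mul_const _
  rw [← Finset.mul_sum, hone, mul_one] at hlim
  exact tendsto_nhds_unique hy hlim

/-- The difference of two antidifferences is a limit of polynomials of bounded degree and has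
period one, so it is constant. -/
theorem IsMSAntidifference.sub_eq_sub {f Q R : ℂ → ℂ} (hQ : IsMSAntidifference rightHalfPlane f Q)
    (hR : IsMSAntidifference rightHalfPlane f R) {y : ℂ} (hy : y + 1 ∈ rightHalfPlane) :
    Q y - Q 0 = R y - R 0 := by
  obtain ⟨P₁, ⟨d₁, hd₁⟩, hlim₁, hdiff₁⟩ := hQ
  obtain ⟨P₂, ⟨d₂, hd₂⟩, hlim₂, hdiff₂⟩ := hR
  have hmem : ∀ i : ℕ, (i : ℂ) + 1 ∈ rightHalfPlane := by
    intro i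
    have : (0 : ℝ) < i + 1 := by positivity
    simpa [rightHalfPlane] using this
  have hconst : ∀ i : ℕ, Q i - R i = Q 0 - R 0 := by
    intro i
    induction i with
    | zero => simp
    | succ i ih =>
      have h1 := hdiff₁ i (hmem i)
      have h2 := hdiff₂ i (hmem i)
      push_cast
      linear_combination h1 - h2 + ih
  have hsub : ∀ w : ℂ, w + 1 ∈ rightHalfPlane →
      Tendsto (fun n => (P₁ n - P₂ n).eval w) atTop (𝓝 (Q w - R w)) := by
    intro w hw
    have h := (hlim₂ w hw).sub (hlim₁ w hw)
    rw [show -R w - -Q w = Q w - R w by ring] at h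
    refine h.congr fun n => ?_
    rw [Polynomial.eval_sub]
    ring
  have h := eq_of_tendsto_eval (P := fun n => P₁ n - P₂ n) (d := max d₁ d₂)
    (fun n => (Polynomial.natDegree_sub_le _ _).trans (max_le_max (hd₁ n) (hd₂ n)))
    (fun i => by simpa only [hconst] using hsub i (hmem i)) (hsub y hy)
  linear_combination h

end Umbral

end

theorem theorem3p2 (p : ℕ) (f : ℂ → ℂ)
    (hf : Umbral.MemHierarchy (-(2 * Real.pi)) 0 (2 * Real.pi) 0 p f)
    (hlim : TendstoLocallyUniformly
      (fun (t ξ : ℝ) => iteratedDeriv p f (t + Complex.I * ξ)) (fun _ => 0) atTop) :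
    Umbral.MSSummable Umbral.rightHalfPlane f ∧
      ∀ z : ℂ, -1 < z.re →
        Umbral.HasUmbralIntegral Umbral.bernoulli f z
          (Umbral.msSum Umbral.rightHalfPlane f 1 z) := by
  have hprim := Umbral.exists_isPrimitive (f := f) hf.2.2.1
  have hsum : Umbral.MSSummable Umbral.rightHalfPlane f :=
    let ⟨_, hF⟩ := hprim
    ⟨_, Umbral.isMSAntidifference_bernoulliValue hF hf hlim⟩
  refine ⟨hsum, fun z hz => ⟨hprim, fun F hF => ?_⟩⟩
  have hz' : z + 1 ∈ Umbral.rightHalfPlane := by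
    have : 0 < z.re + 1 := by linarith
    simpa [Umbral.rightHalfPlane] using this
  refine ⟨Umbral.bernoulliValue F 0, Umbral.bernoulliValue F z, ?_,
    Umbral.hasEval_bernoulliValue hf hF hz, ?_⟩
  · simpa using Umbral.hasEval_bernoulliValue hf hF (z := 0) (by simp)
  · rw [Umbral.msSum, dif_pos hsum, sub_self, hsum.choose_spec.sub_eq_sub
      (Umbral.isMSAntidifference_bernoulliValue hF hf hlim) hz']
    ring
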